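/- Theorem 4.1. Let $p,q\in\mathbb C[x]$ and consider the Abel equation $y'=p(x)y^2+q(x)y^3$. Let $a,b\in\mathbb C$ with $q(b)\neq 0$, let $s:[0,1]\to\mathbb C$ be a continuous path from $a$ to $b$, and let $y_a^0\in\mathbb C$. For $y_a\in\mathbb C$ denote by $y(y_a,\cdot)$ the local solution near $a$ with value $y_a$ at $a$. Assume that $y(y_a^0,\cdot)$ can be analytically continued along $s|_{[0,1)}$, but not along the whole of $s$ (it has a singularity at $b$). The germ at $y_1$ of the Poincaré mapping $\phi$ along $s$ sends each $y_a$ near $y_1$ to the value at $b$ of the analytic continuation of $y(y_a,\cdot)$ along $s$; it is defined at $y_1$ if these continuations exist for all $y_a$ near $y_1$. Then there are an open neighbourhood $V$ of $y_a^0$, a parameter $c\in[0,1)$, a disk $D$ centred at $b$ with $s([c,1])\subset D$, and an injective holomorphic function $x_0:V\to D$ with nowhere vanishing derivative and $x_0(y_a^0)=b$, such that for each $y_a\in V$ the following holds. One has $s(c)\ne x_0(y_a)$, the solution $y(y_a,\cdot)$ continues analytically along $s|_{[0,c]}$, and $x_0(y_a)$ is the only singular point in $D$ of the resulting local branch: the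 branch continues along every path in $D\setminus\{x_0(y_a)\}$ starting at $s(c)$, and does not continue along any path in $D$ from $s(c)$ to $x_0(y_a)$ that reaches $x_0(y_a)$ only at its end. Put $$\gamma=\{y_a\in V:\ x_0(y_a)\in s([c,1])\}.$$ 1. The germ of $\gamma$ at $y_a^0$ is a germ of a real curve: there are $c'\in[c,1)$ and a continuous $\kappa:[c',1]\to V$ with $\kappa(1)=y_a^0$ and $x_0\circ\kappa=s|_{[c',1]}$ such that $\gamma$ coincides with $\kappa([c',1])$ in a neighbourhood of $y_a^0$; moreover $\kappa$ is of class $C^n$ ($n\le\infty$) on every set on which $s$ is. 2. For each $y_a\in V\setminus\gamma$ the germ at $y_a$ of the Poincaré mapping along $s$ is defined and regular (holomorphic). 3. There are $\rho>0$ with $\{|y_a-y_a^0|<\rho\}\subset V$ and coefficients $\nu_k\in\mathbb C$ $(k\ge 0)$ with $\nu_0\neq0$ such that, with $U_0=\{0<|y_a-y_a^0|<\rho\}$, the germs of the Poincaré mapping along $s$ at the points of $U_0\setminus\gamma$ can be analytically continued along all paths in $U_0$ (in particular across $\gamma$) and form one double-valued regular function on $U_0$, represented by the Puiseux series $$y(b)=\frac1{\sqrt{y_a-y_a^0}}\sum_{k=0}^\infty\nu_k\,(y_a-y_a^0)^{k/2},$$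 convergent in $U_0$. That is, for every $z\in U_0$ and every starting point $y_1\in U_0\setminus\gamma$, the values at $z$ of the analytic continuations in $U_0$ of the germ at $y_1$ are exactly the values of this series at $y_a=z$ for the two choices of $\sqrt{z-y_a^0}$ (the same choice in all terms), and these two values are distinct. -/

import Mathlib

open Set Filter
open scoped Topology unitInterval

/-- `f` is an analytic continuation along the part `J` of the path `s`: for every `t ∈ J` the germ
of `f t` at `s t` is analytic, and the germs with parameter close to `t` are the germs of `f t`. -/
def IsAnalyticContinuation {a b : ℂ} (s : Path a b) (J : Set I) (f : I → ℂ → ℂ) : Prop :=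
  ∀ t ∈ J, AnalyticAt ℂ (f t) (s t) ∧ ∀ᶠ t' in 𝓝[J] t, f t' =ᶠ[𝓝 (s t')] f t

/-- The germ of `g` at `a` has an analytic continuation along the whole path `s`. -/
def GermContinues {a b : ℂ} (g : ℂ → ℂ) (s : Path a b) : Prop :=
  ∃ f : I → ℂ → ℂ, IsAnalyticContinuation s univ f ∧ f 0 =ᶠ[𝓝 a] g

/-- All the values at `z` of the analytic continuations of the germ of `g` at `y` along paths
from `y` to `z` inside `U`. -/
def continuationValues (g : ℂ → ℂ) (U : Set ℂ) (y z : ℂ) : Set ℂ :=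
  {v | ∃ (τ : Path y z) (f : I → ℂ → ℂ), (∀ t, τ t ∈ U) ∧
    IsAnalyticContinuation τ univ f ∧ f 0 =ᶠ[𝓝 y] g ∧ f 1 z = v}

/-- Near `a`, `g` is a solution of the Abel equation `y' = p(x) y² + q(x) y³`, and `g a = y`. -/
def IsAbelSolutionGerm (p q : Polynomial ℂ) (a y : ℂ) (g : ℂ → ℂ) : Prop :=
  g a = y ∧ ∀ᶠ x in 𝓝 a, HasDerivAt g (p.eval x * g x ^ 2 + q.eval x * g x ^ 3) x

/-- `f` is the analytic continuation, along the part `J ∋ 0` of the path `s` from `a`, of the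
solution of the Abel equation that takes the value `y` at `a`. -/
def SolutionContinues (p q : Polynomial ℂ) {a b : ℂ} (s : Path a b) (J : Set I) (y : ℂ)
    (f : I → ℂ → ℂ) : Prop :=
  IsAbelSolutionGerm p q a y (f 0) ∧ IsAnalyticContinuation s J f

/-- `φ` represents the germ at `y₁` of the Poincaré mapping along the path `s` from `a` to `b`:
for each `y` near `y₁`, the solution with value `y` at `a` continues along `s` up to and
including `b`, and its value at `b` is `φ y`. -/
def IsPoincareGerm (p q : Polynomial ℂ) {a b : ℂ} (s : Path a b) (y₁ : ℂ) (φ : ℂ → ℂ) : Prop :=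
  ∀ᶠ y in 𝓝 y₁, ∃ f : I → ℂ → ℂ, SolutionContinues p q s univ y f ∧ f 1 b = φ y

/-- `x` is the only singular point in `D` of the local branch obtained by continuing the solution
with value `y` at `a` along `s` up to `s c`: this branch continues along every path from `s c`
in `D` that avoids `x`, and along no path in `D` that reaches `x` (for the first time) at its
endpoint. -/
def IsOnlySingularity (p q : Polynomial ℂ) {a b : ℂ} (s : Path a b) (c : I) (D : Set ℂ)
    (y x : ℂ) : Prop :=
  x ∈ D ∧ s c ∈ D ∧ s c ≠ x ∧
  ∃ f : I → ℂ → ℂ, SolutionContinues p q s (Iic c) y f ∧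
    (∀ (d : ℂ) (τ : Path (s c) d), (∀ t, τ t ∈ D \ {x}) → GermContinues (f c) τ) ∧
    (∀ τ : Path (s c) x, (∀ t, τ t ∈ D) → (∀ t < 1, τ t ≠ x) → ¬ GermContinues (f c) τ)

/-- The Puiseux series `w⁻¹ ∑ ν_k w^k`, where `w` is a choice of the square root. -/
noncomputable def puiseuxSum (ν : ℕ → ℂ) (w : ℂ) : ℂ := w⁻¹ * ∑' k : ℕ, ν k * w ^ k

/-! In the coordinate `v = 1/y` the equation becomes `v dv = -(p v + q) dx`. Since `q(b) ≠ 0`, near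
`(v, x) = (0, b)` the solution curves are smooth and fold simply over the `x`-line: each meets `v =
0` at one point `ξ`, where `x - ξ` vanishes to order exactly two in `v`. So `x = ξ + w²`, `v = w
m(w, ξ)` uniformizes them, with `m` analytic and nonvanishing (`exists_singular_leaves`). A solution
with large values near `b` is thus `1/(w m(w, ξ))` with `w = √(x - ξ)`; it continues wherever the
root can be followed, and blows up at `ξ` (`IsLeafChart.exists_continuation`,
`IsLeafChart.ne_of_continuation`).

The given solution tends to infinity at the end of the path
(`SolutionContinues.tendsto_norm_atTop`), so late on the path it lies on such a leaf. Its value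
there depends biholomorphically on the initial value
(`SolutionContinues.exists_analytic_dependence`), and the singular point `ξ` of the leaf is a local
coordinate on the transversal. This makes `x₀` locally biholomorphic
(`exists_singularity_position`). The curve `γ` is a local preimage of the path under `x₀`; off `γ`
the path misses the singular point and the solution reaches `b`.

The value reached is `1/(w' m(w', x₀ y))` with `w'² = b - x₀ y`. As `b - x₀` has a simple zero at
`y₀`, `w'` is `√(y - y₀)` times an analytic unit, which gives the Puiseux series
(`IsLeafChart.exists_puiseux`). A turn around `y₀` changes the sign of the root, so both branches
occur.

Both the regular flow and the leaves come from integral equations in the Banach space `C(I, ℂ)`,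
solved by the analytic implicit function theorem; analytic dependence on all parameters is then
automatic. -/

/-- The analytic implicit function theorem for an equation whose partial derivative with respect
to the unknown is a nonzero scalar, with local uniqueness. -/
theorem exists_analytic_implicit {P E : Type*} [NormedAddCommGroup P] [NormedSpace ℂ P]
    [CompleteSpace P] [NormedAddCommGroup E] [NormedSpace ℂ E] [CompleteSpace E]
    {Φ : P × E → E} {π₀ : P} {z₀ : E} (hΦ : ContDiffAt ℂ ⊤ Φ (π₀, z₀)) (h0 : Φ (π₀, z₀) = 0)
    {c : ℂ} (hc : c ≠ 0)
    (hd : HasFDerivAt (fun z => Φ (π₀, z)) (c • ContinuousLinearMap.id ℂ E) z₀) :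
    ∃ Z : P → E, AnalyticAt ℂ Z π₀ ∧ Z π₀ = z₀ ∧ (∀ᶠ π in 𝓝 π₀, Φ (π, Z π) = 0) ∧
      ∀ᶠ x in 𝓝 (π₀, z₀), Φ x = 0 → x.2 = Z x.1 := by
  have hs := hΦ.hasStrictFDerivAt (by simp)
  have hpart : fderiv ℂ Φ (π₀, z₀) ∘L .inr ℂ P E = c • ContinuousLinearMap.id ℂ E :=
    (HasFDerivAt.comp z₀ hs.hasFDerivAt (hasFDerivAt_prodMk_right π₀ z₀)).unique hd
  have hinv : (fderiv ℂ Φ (π₀, z₀) ∘L .inr ℂ P E).IsInvertible := by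
    rw [hpart]
    exact ⟨ContinuousLinearEquiv.smulLeft (Units.mk0 c hc), by ext; simp⟩
  refine ⟨hΦ.implicitFunction (by simp) hinv, (hΦ.contDiffAt_implicitFunction (by simp) hinv).analyticAt,
    hΦ.implicitFunction_apply_self (by simp) hinv, ?_, ?_⟩
  · simpa [h0] using hΦ.eventually_apply_implicitFunction (by simp) hinv
  · filter_upwards [hΦ.eventually_apply_eq_iff_implicitFunction (by simp) hinv] with x hx h
    exact (hx.1 (h.trans h0.symm)).symm

/-! ### Averaging and rescaling operators on `C(I, ℂ)` -/

theorem continuous_weighted_average (j : ℕ) (h : C(I, ℂ)) :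
    Continuous fun t : I => ∫ u : I, ((u : ℝ) : ℂ) ^ j * h (t * u) := by
  have := continuous_parametric_integral_of_continuous (μ := (MeasureTheory.volume : MeasureTheory.Measure I))
    (f := fun t u : I => ((u : ℝ) : ℂ) ^ j * h (t * u)) (by fun_prop) isCompact_univ
  simpa using this

theorem integrable_weighted (j : ℕ) (h : C(I, ℂ)) (t : I) :
    MeasureTheory.Integrable fun u : I => ((u : ℝ) : ℂ) ^ j * h (t * u) :=
  (Continuous.integrable_of_hasCompactSupport (by fun_prop) (HasCompactSupport.of_compactSpace _))

/-- The averaging operator `h ↦ (t ↦ ∫₀¹ u ^ j h(tu) du)`. -/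
noncomputable def weightedAverage (j : ℕ) : C(I, ℂ) →L[ℂ] C(I, ℂ) :=
  LinearMap.mkContinuous
    { toFun := fun h => ⟨_, continuous_weighted_average j h⟩
      map_add' := fun h k => by
        ext t
        simp only [ContinuousMap.coe_mk, ContinuousMap.add_apply, mul_add]
        exact MeasureTheory.integral_add (integrable_weighted j h t) (integrable_weighted j k t)
      map_smul' := fun c h => by
        ext t
        simp only [ContinuousMap.coe_mk, ContinuousMap.smul_apply, smul_eq_mul, RingHom.id_apply]
        rw [← MeasureTheory.integral_const_mul]
        congr 1; ext u; ring } 1 (by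
    intro h
    rw [one_mul]
    refine (ContinuousMap.norm_le _ (norm_nonneg _)).2 fun t => ?_
    refine (MeasureTheory.norm_integral_le_of_norm_le_const (C := ‖h‖)
      (Eventually.of_forall fun u => ?_)).trans (by simp)
    rw [norm_mul, norm_pow, Complex.norm_real, Real.norm_of_nonneg u.2.1]
    exact (mul_le_of_le_one_left (norm_nonneg _) (pow_le_one₀ u.2.1 u.2.2)).trans
      (h.norm_coe_le_norm _))

theorem weightedAverage_apply (j : ℕ) (h : C(I, ℂ)) (t : I) :
    weightedAverage j h t = ∫ u : I, ((u : ℝ) : ℂ) ^ j * h (t * u) := rfl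

/-- The inclusion of the unit interval into `ℂ`. -/
noncomputable def unitIncl : C(I, ℂ) := ⟨fun t => ((t : ℝ) : ℂ), by fun_prop⟩

@[simp] theorem unitIncl_apply (t : I) : unitIncl t = ((t : ℝ) : ℂ) := rfl

/-- Precomposition with multiplication by `t`. -/
noncomputable def rescale (t : I) (z : C(I, ℂ)) : C(I, ℂ) := ⟨fun s => z (t * s), by fun_prop⟩

@[simp] theorem rescale_apply (t s : I) (z : C(I, ℂ)) : rescale t z s = z (t * s) := rfl

theorem dist_rescale_const_le (t : I) (z : C(I, ℂ)) (c : ℂ) :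
    dist (rescale t z) (ContinuousMap.const I c) ≤ dist z (ContinuousMap.const I c) := by
  refine (ContinuousMap.dist_le dist_nonneg).2 fun s => ?_
  exact ContinuousMap.dist_apply_le_dist (f := z) (g := ContinuousMap.const I c) (t * s)

theorem mul_mem_ball_zero {r : ℝ} {l : ℂ} (hl : l ∈ Metric.ball (0 : ℂ) r) (t : I) :
    ((t : ℝ) : ℂ) * l ∈ Metric.ball (0 : ℂ) r := by
  rw [mem_ball_zero_iff] at hl ⊢
  rw [norm_mul, Complex.norm_real, Real.norm_of_nonneg t.2.1]
  exact (mul_le_of_le_one_left (norm_nonneg _) t.2.2).trans_lt hl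

/-- A function given by a radial integral is a primitive of the integrand. -/
theorem hasDerivAt_of_eq_radial_integral {r : ℝ} {k G : ℂ → ℂ} {C : ℂ}
    (hk : DifferentiableOn ℂ k (Metric.ball 0 r))
    (hG : ∀ l ∈ Metric.ball (0 : ℂ) r, G l = C + l * ∫ u : I, k (((u : ℝ) : ℂ) * l)) {l : ℂ}
    (hl : l ∈ Metric.ball (0 : ℂ) r) : HasDerivAt G (k l) l := by
  -- A holomorphic function on a disk has a primitive there; normalized to `C` at `0`, it equals `G`
  -- by the fundamental theorem of calculus on radii.
  obtain ⟨K, hK0, hK⟩ := hk.isExactOn_ball.with_val_at 0 C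
  refine (hK l hl).congr_of_eventuallyEq ?_
  filter_upwards [Metric.isOpen_ball.mem_nhds hl] with w hw
  rw [hG w hw, ← hK0]
  have h1 : ∀ x ∈ uIcc (0 : ℝ) 1, HasDerivAt (fun u : ℝ => K ((u : ℂ) * w)) (w * k ((x : ℂ) * w)) x := by
    intro x hx
    rw [uIcc_of_le zero_le_one] at hx
    have h2 := hK _ (mul_mem_ball_zero hw ⟨x, hx⟩)
    have h3 : HasDerivAt (fun u : ℝ => (u : ℂ) * w) w x := by
      simpa using (Complex.ofRealCLM.hasDerivAt (x := x)).mul_const w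
    rw [mul_comm]
    exact HasDerivAt.comp x h2 h3
  have hcont : ContinuousOn (fun x : ℝ => w * k ((x : ℂ) * w)) (uIcc (0 : ℝ) 1) := by
    refine continuousOn_const.mul (hk.continuousOn.comp (by fun_prop) ?_)
    intro x hx
    rw [uIcc_of_le zero_le_one] at hx
    exact mul_mem_ball_zero hw ⟨x, hx⟩
  have h4 := intervalIntegral.integral_eq_sub_of_hasDerivAt h1 hcont.intervalIntegrable
  rw [intervalIntegral.integral_const_mul, intervalIntegral.integral_of_le zero_le_one,
    ← MeasureTheory.integral_Icc_eq_integral_Ioc,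
    ← MeasureTheory.integral_subtype measurableSet_Icc (fun u : ℝ => k ((u : ℂ) * w))] at h4
  simp only [Complex.ofReal_one, one_mul, Complex.ofReal_zero, zero_mul] at h4
  rw [eq_add_of_sub_eq' h4.symm]

/-- Constant functions, as a continuous linear map. -/
noncomputable def constIncl : ℂ →L[ℂ] C(I, ℂ) := algebraMapCLM ℂ C(I, ℂ)

@[simp] theorem constIncl_apply (c : ℂ) (t : I) : constIncl c t = c := rfl

theorem ContDiff.aeval_continuousMap (p : Polynomial ℂ) {E : Type*} [NormedAddCommGroup E]
    [NormedSpace ℂ E] {h : E → C(I, ℂ)} (hh : ContDiff ℂ ⊤ h) :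
    ContDiff ℂ ⊤ fun w => Polynomial.aeval (h w) p := by
  induction p using Polynomial.induction_on' with
  | add p q hp hq => simpa using hp.add hq
  | monomial n c =>
    simp only [Polynomial.aeval_monomial]
    fun_prop

/-! ### The local flow of the Abel equation -/

/-- The right-hand side of the Abel equation. -/
noncomputable def abelField (p q : Polynomial ℂ) (x y : ℂ) : ℂ :=
  p.eval x * y ^ 2 + q.eval x * y ^ 3

theorem AnalyticAt.abelField_comp {p q : Polynomial ℂ} {f g : ℂ → ℂ} {x : ℂ} (hf : AnalyticAt ℂ f x)
    (hg : AnalyticAt ℂ g x) : AnalyticAt ℂ (fun t => abelField p q (f t) (g t)) x := by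
  unfold abelField
  have hp := (AnalyticAt.aeval_polynomial hf p)
  have hq := (AnalyticAt.aeval_polynomial hf q)
  simp only [Polynomial.coe_aeval_eq_eval] at hp hq
  fun_prop

/-- The integral equation of the Abel equation along the segment from `x` to `x + l` with initial
value `v`, as an equation in `C(I, ℂ)`. -/
noncomputable def abelIntegralEq (p q : Polynomial ℂ) (w : (ℂ × ℂ × ℂ) × C(I, ℂ)) : C(I, ℂ) :=
  w.2 - constIncl w.1.2.2 - constIncl w.1.2.1 * (unitIncl * weightedAverage 0
    (Polynomial.aeval (constIncl w.1.1 + constIncl w.1.2.1 * unitIncl) p * w.2 ^ 2 +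
      Polynomial.aeval (constIncl w.1.1 + constIncl w.1.2.1 * unitIncl) q * w.2 ^ 3))

theorem abelIntegralEq_apply (p q : Polynomial ℂ) (x l v : ℂ) (z : C(I, ℂ)) (s : I) :
    abelIntegralEq p q ((x, l, v), z) s = z s - v - l * ((s : ℝ) * ∫ u : I,
      abelField p q (x + l * ((s : ℝ) * (u : ℝ))) (z (s * u))) := by
  simp only [abelIntegralEq, weightedAverage_apply, abelField, ContinuousMap.sub_apply,
    ContinuousMap.mul_apply, ContinuousMap.add_apply, constIncl_apply, unitIncl_apply, pow_zero,
    one_mul, ContinuousMap.pow_apply, Polynomial.aeval_continuousMap_apply, Set.Icc.coe_mul,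
    Complex.ofReal_mul]

theorem contDiff_abelIntegralEq (p q : Polynomial ℂ) : ContDiff ℂ ⊤ (abelIntegralEq p q) := by
  unfold abelIntegralEq
  have h : ContDiff ℂ ⊤ fun w : (ℂ × ℂ × ℂ) × C(I, ℂ) =>
    (constIncl w.1.1 + constIncl w.1.2.1 * unitIncl) := by fun_prop
  have hp := h.aeval_continuousMap p
  have hq := h.aeval_continuousMap q
  fun_prop

/-- An initial part of a solution on the segment of length `l` solves the equation for `t l`. With
uniqueness, the value at `t` for `l` is the value at `1` for `t l`, so evaluation at `1` retains the
whole solution. -/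
theorem abelIntegralEq_rescale (p q : Polynomial ℂ) (x l v : ℂ) (z : C(I, ℂ)) (t : I) :
    abelIntegralEq p q ((x, (t : ℝ) * l, v), rescale t z) =
      rescale t (abelIntegralEq p q ((x, l, v), z)) := by
  ext s
  rw [rescale_apply, abelIntegralEq_apply, abelIntegralEq_apply]
  simp only [rescale_apply, mul_assoc, Set.Icc.coe_mul, Complex.ofReal_mul]
  congr 1
  rw [mul_left_comm]
  congr 4
  ext u
  congr 2
  ring

/-- Near every point, the solutions of the Abel equation exist on a common disk and depend
biholomorphically on the initial value. -/
theorem exists_uniform_abel_flow (p q : Polynomial ℂ) (x₁ y₁ : ℂ) :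
    ∃ ε > 0, ∃ u : ℂ → ℂ → ℂ → ℂ, ∀ x ∈ Metric.ball x₁ ε, ∀ y ∈ Metric.ball y₁ ε, u x y x = y ∧
      ∀ x' ∈ Metric.ball x₁ ε, HasDerivAt (u x y) (abelField p q x' (u x y x')) x' ∧
        AnalyticAt ℂ (fun v => u x v x') y ∧ deriv (fun v => u x v x') y ≠ 0 := by
  -- At `l = 0` the equation reads `z = v`, so the partial derivative in `z` is the identity.
  obtain ⟨Z, hZ, hZ0, hZeq, hZuniq⟩ := exists_analytic_implicit (Φ := abelIntegralEq p q)
    (π₀ := (x₁, 0, y₁)) (z₀ := constIncl y₁) (contDiff_abelIntegralEq p q).contDiffAt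
    (by simp [abelIntegralEq]) one_ne_zero (by
      simp only [abelIntegralEq, map_zero, zero_mul, sub_zero, one_smul]
      exact (hasFDerivAt_id _).sub_const _)
  set g : ℂ × ℂ × ℂ → ℂ := fun π => Z π 1 with hg
  have hev : ∀ π, AnalyticAt ℂ Z π → AnalyticAt ℂ g π := fun π h =>
    AnalyticAt.comp ((ContinuousMap.evalCLM ℂ (1 : I) : C(I, ℂ) →L[ℂ] ℂ).analyticAt (Z π)) h
  have hzero : ∀ π : ℂ × ℂ × ℂ, abelIntegralEq p q (π, Z π) = 0 → π.2.1 = 0 → g π = π.2.2 := by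
    rintro ⟨x, l, v⟩ h hl
    have := DFunLike.congr_fun h 1
    simp only at hl
    rw [abelIntegralEq_apply, hl] at this
    simpa [sub_eq_zero, hg, hl] using this
  -- At `l = 0` the flow is the identity in `v`, with derivative `1`; continuity does the rest.
  have hD : ∀ᶠ π in 𝓝 (x₁, (0 : ℂ), y₁), fderiv ℂ g π (0, 0, 1) ≠ 0 := by
    have hc : ContinuousAt (fun π => fderiv ℂ g π (0, 0, 1)) (x₁, (0 : ℂ), y₁) :=
      ((hev _ hZ).fderiv.continuousAt).clm_apply continuousAt_const
    refine hc.eventually_ne ?_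
    have h1 : HasDerivAt (fun v : ℂ => (x₁, (0 : ℂ), v)) (0, 0, 1) y₁ :=
      (hasDerivAt_const _ _).prodMk ((hasDerivAt_const _ _).prodMk (hasDerivAt_id _))
    have h2 := (hev _ hZ).differentiableAt.hasFDerivAt.comp_hasDerivAt y₁ h1
    have h3 : (g ∘ fun v : ℂ => (x₁, (0 : ℂ), v)) =ᶠ[𝓝 y₁] id := by
      have : Tendsto (fun v : ℂ => (x₁, (0 : ℂ), v)) (𝓝 y₁) (𝓝 (x₁, 0, y₁)) :=
        h1.continuousAt
      filter_upwards [this.eventually hZeq] with v hv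
      exact hzero _ hv rfl
    rw [(h2.congr_of_eventuallyEq h3.symm).unique (hasDerivAt_id _)]
    exact one_ne_zero
  obtain ⟨δ, hδ, hδu⟩ := Metric.eventually_nhds_iff.1 hZuniq
  have hclose : ∀ᶠ π in 𝓝 (x₁, (0 : ℂ), y₁), dist (Z π) (constIncl y₁) < δ := by
    have := hZ.continuousAt.eventually (Metric.ball_mem_nhds _ hδ)
    rwa [hZ0] at this
  obtain ⟨e, he, hball⟩ := Metric.eventually_nhds_iff.1
    (hZeq.and (hZ.eventually_analyticAt.and (hD.and (hclose.and
      (Metric.ball_mem_nhds (x₁, (0 : ℂ), y₁) hδ)))))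
  have hmem : ∀ x l v, dist x x₁ < e → ‖l‖ < e → dist v y₁ < e →
      dist (x, l, v) (x₁, (0 : ℂ), y₁) < e := by
    intro x l v h1 h2 h3
    simp only [Prod.dist_eq, dist_zero_right, max_lt_iff]
    exact ⟨h1, h2, h3⟩
  have hscale : ∀ x l v, dist x x₁ < e → ‖l‖ < e → dist v y₁ < e → ∀ t : I,
      Z (x, (t : ℝ) * l, v) = rescale t (Z (x, l, v)) := by
    intro x l v h1 h2 h3 t
    have ht := mul_mem_ball_zero (mem_ball_zero_iff.2 h2) t
    rw [mem_ball_zero_iff] at ht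
    have hb := hball (hmem x l v h1 h2 h3)
    have hb' := hball (hmem x _ v h1 ht h3)
    -- Local uniqueness applies because rescaling does not increase the distance to a constant.
    refine (@hδu ((x, (t : ℝ) * l, v), rescale t (Z (x, l, v))) ?_ ?_).symm
    · rw [Prod.dist_eq, max_lt_iff]
      refine ⟨hb'.2.2.2.2, lt_of_le_of_lt ?_ hb.2.2.2.1⟩
      exact dist_rescale_const_le _ _ _
    · rw [abelIntegralEq_rescale, hb.1]
      ext; simp
  have hderiv : ∀ x v, dist x x₁ < e → dist v y₁ < e → ∀ l ∈ Metric.ball (0 : ℂ) e,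
      HasDerivAt (fun l => g (x, l, v)) (abelField p q (x + l) (g (x, l, v))) l := by
    intro x v h1 h3 l hl
    have hgl : ∀ l ∈ Metric.ball (0 : ℂ) e, AnalyticAt ℂ (fun l => g (x, l, v)) l := fun l hl =>
      (hev _ (hball (hmem x l v h1 (mem_ball_zero_iff.1 hl) h3)).2.1).comp (g := g)
        (f := fun l => (x, l, v)) (by fun_prop)
    refine hasDerivAt_of_eq_radial_integral (C := v) (r := e)
      (k := fun l => abelField p q (x + l) (g (x, l, v))) ?_ ?_ hl
    · exact fun l hl => (AnalyticAt.abelField_comp (analyticAt_const.add analyticAt_id)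
        (hgl l hl)).differentiableAt.differentiableWithinAt
    · intro l hl
      have hl' := mem_ball_zero_iff.1 hl
      have h := DFunLike.congr_fun (hball (hmem x l v h1 hl' h3)).1 1
      rw [abelIntegralEq_apply] at h
      simp only [hg]
      rw [ContinuousMap.zero_apply, sub_sub, sub_eq_zero] at h
      rw [h]
      simp only [one_mul, Set.Icc.coe_one, Complex.ofReal_one]
      congr 2
      congr 1
      ext u
      rw [hscale x l v h1 hl' h3 u, rescale_apply, mul_one, mul_comm l]
  -- Half the radius, since the increment `x' - x` between two points of the disk must have norm
  -- below `e`.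
  refine ⟨e / 2, by positivity, fun x v x' => g (x, x' - x, v), ?_⟩
  intro x hx v hv
  have hx1 : dist x x₁ < e := (Metric.mem_ball.1 hx).trans (by linarith)
  have hv1 : dist v y₁ < e := (Metric.mem_ball.1 hv).trans (by linarith)
  refine ⟨?_, fun x' hx' => ?_⟩
  · refine (congrArg g ?_).trans (hzero (x, 0, v) (hball (hmem x 0 v hx1 (by simpa) hv1)).1 rfl)
    simp
  have hl : ‖x' - x‖ < e := by
    rw [← dist_eq_norm]
    refine (dist_triangle_right _ _ x₁).trans_lt ?_
    have := Metric.mem_ball.1 hx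
    have := Metric.mem_ball.1 hx'
    linarith
  have hb := hball (hmem x _ v hx1 hl hv1)
  refine ⟨?_, ?_, ?_⟩
  · have := (hderiv x v hx1 hv1 (x' - x) (mem_ball_zero_iff.2 hl)).comp_sub_const x' x
    simpa using this
  · exact (hev _ hb.2.1).comp (g := g) (f := fun v => (x, x' - x, v)) (by fun_prop)
  · have h1 : HasDerivAt (fun v : ℂ => (x, x' - x, v)) (0, 0, 1) v :=
      (hasDerivAt_const _ _).prodMk ((hasDerivAt_const _ _).prodMk (hasDerivAt_id _))
    have h2 := (hev _ hb.2.1).differentiableAt.hasFDerivAt.comp_hasDerivAt v h1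
    have h3 : deriv (fun v => g (x, x' - x, v)) v = _ := h2.deriv
    rw [h3]
    exact hb.2.2.1

/-! ### Leaves with large values near `b` -/

/-- The right-hand side of the equation of a leaf `v = 1 / y` of the Abel equation in the
uniformizing parameter `w`, where `x = ξ + w ^ 2`: half the derivative of `v ^ 2` is
`-2 w (p v + q)`. -/
noncomputable def leafField (p q : Polynomial ℂ) (w ξ v : ℂ) : ℂ :=
  p.eval (ξ + w ^ 2) * v + q.eval (ξ + w ^ 2)

theorem AnalyticAt.leafField_comp {p q : Polynomial ℂ} {f g : ℂ → ℂ} {ξ w : ℂ} (hf : AnalyticAt ℂ f w)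
    (hg : AnalyticAt ℂ g w) : AnalyticAt ℂ (fun t => leafField p q (f t) ξ (g t)) w := by
  unfold leafField
  have h : AnalyticAt ℂ (fun t => ξ + f t ^ 2) w := by fun_prop
  have hp := h.aeval_polynomial p
  have hq := h.aeval_polynomial q
  simp only [Polynomial.coe_aeval_eq_eval] at hp hq
  fun_prop

/-- The integral equation for the leaf through `(ξ, 0)`, divided by `w ^ 2`, as an equation in
`C(I, ℂ)`. -/
noncomputable def leafIntegralEq (p q : Polynomial ℂ) (x : (ℂ × ℂ) × C(I, ℂ)) : C(I, ℂ) :=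
  x.2 ^ 2 + constIncl 4 * weightedAverage 1
    (Polynomial.aeval (constIncl x.1.2 + (constIncl x.1.1 * unitIncl) ^ 2) p *
        (constIncl x.1.1 * unitIncl * x.2) +
      Polynomial.aeval (constIncl x.1.2 + (constIncl x.1.1 * unitIncl) ^ 2) q)

theorem leafIntegralEq_apply (p q : Polynomial ℂ) (w ξ : ℂ) (z : C(I, ℂ)) (s : I) :
    leafIntegralEq p q ((w, ξ), z) s = z s ^ 2 + 4 * ∫ u : I, ((u : ℝ) : ℂ) *
      leafField p q (w * ((s : ℝ) * (u : ℝ))) ξ (w * ((s : ℝ) * (u : ℝ)) * z (s * u)) := by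
  simp only [leafIntegralEq, weightedAverage_apply, leafField,
    ContinuousMap.mul_apply, ContinuousMap.add_apply, constIncl_apply, unitIncl_apply, pow_one,
    ContinuousMap.pow_apply, Polynomial.aeval_continuousMap_apply, Set.Icc.coe_mul,
    Complex.ofReal_mul]

theorem contDiff_leafIntegralEq (p q : Polynomial ℂ) : ContDiff ℂ ⊤ (leafIntegralEq p q) := by
  unfold leafIntegralEq
  have h : ContDiff ℂ ⊤ fun x : (ℂ × ℂ) × C(I, ℂ) =>
    (constIncl x.1.2 + (constIncl x.1.1 * unitIncl) ^ 2) := by fun_prop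
  have hp := h.aeval_continuousMap p
  have hq := h.aeval_continuousMap q
  fun_prop

theorem leafIntegralEq_rescale (p q : Polynomial ℂ) (w ξ : ℂ) (z : C(I, ℂ)) (t : I) :
    leafIntegralEq p q (((t : ℝ) * w, ξ), rescale t z) =
      rescale t (leafIntegralEq p q ((w, ξ), z)) := by
  ext s
  rw [rescale_apply, leafIntegralEq_apply, leafIntegralEq_apply]
  have h : ∀ u : I, (((t : ℝ) : ℂ) * w) * ((s : ℝ) * (u : ℝ)) = w * (((t : ℝ) * (s : ℝ)) * (u : ℝ)) :=
    fun u => by ring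
  simp only [rescale_apply, mul_assoc t s, Set.Icc.coe_mul, Complex.ofReal_mul, h]

theorem integral_unitInterval_coe : ∫ u : I, ((u : ℝ) : ℂ) = 1 / 2 := by
  have h := MeasureTheory.integral_subtype (measurableSet_Icc (a := (0 : ℝ)) (b := 1))
    (fun u : ℝ => (u : ℂ))
  refine h.trans ?_
  rw [MeasureTheory.integral_Icc_eq_integral_Ioc, ← intervalIntegral.integral_of_le zero_le_one,
    intervalIntegral.integral_ofReal]
  simp

/-- Near a point `b` with `q b ≠ 0`, the solutions of the Abel equation with large values are
`y = 1 / (w m(w, ξ))` with `x = ξ + w ^ 2`, where `m` is analytic and does not vanish. -/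
theorem exists_singular_leaves (p q : Polynomial ℂ) {b : ℂ} (hb : q.eval b ≠ 0) :
    ∃ (m : ℂ × ℂ → ℂ) (δ : ℝ), 0 < δ ∧ m (0, b) ≠ 0 ∧
      ∀ w ∈ Metric.ball (0 : ℂ) δ, ∀ ξ ∈ Metric.ball b δ, AnalyticAt ℂ m (w, ξ) ∧
        ‖m (w, ξ) - m (0, b)‖ < ‖m (0, b)‖ ∧
        (w * m (w, ξ)) * deriv (fun w => w * m (w, ξ)) w =
          -2 * w * leafField p q w ξ (w * m (w, ξ)) := by
  -- At `w = 0` the equation reduces to `z² + 2 q(b) = 0`. A root is nonzero, so the partial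
  -- derivative `2 m₀` is invertible.
  obtain ⟨m₀, hm₀⟩ := IsAlgClosed.exists_pow_nat_eq (-2 * q.eval b) (n := 2) (by norm_num)
  have hm₀0 : m₀ ≠ 0 := by
    rintro rfl
    simp [hb] at hm₀
  have heq0 : leafIntegralEq p q ((0, b), constIncl m₀) = 0 := by
    ext s
    rw [leafIntegralEq_apply, constIncl_apply, hm₀]
    simp only [leafField, zero_mul, mul_zero, zero_add, ne_eq, OfNat.ofNat_ne_zero,
      not_false_eq_true, zero_pow, add_zero, ContinuousMap.zero_apply]
    rw [MeasureTheory.integral_mul_const, integral_unitInterval_coe]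
    ring
  obtain ⟨Z, hZ, hZ0, hZeq, hZuniq⟩ := exists_analytic_implicit (Φ := leafIntegralEq p q)
    (π₀ := (0, b)) (z₀ := constIncl m₀) (contDiff_leafIntegralEq p q).contDiffAt heq0
    (mul_ne_zero two_ne_zero hm₀0) (by
      simp only [leafIntegralEq, map_zero, zero_mul, mul_zero, zero_add]
      refine (((hasFDerivAt_id (𝕜 := ℂ) (constIncl m₀)).pow 2).add_const _).congr_fderiv ?_
      ext z t
      simp only [ContinuousLinearMap.id_apply, id_eq, nsmul_eq_mul, _root_.smul_apply,
        smul_eq_mul, ContinuousMap.mul_apply, ContinuousMap.smul_apply, Nat.add_one_sub_one,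
        pow_one, constIncl_apply, Nat.cast_ofNat]
      rfl)
  set g : ℂ × ℂ → ℂ := fun π => Z π 1 with hg
  have hev : ∀ π, AnalyticAt ℂ Z π → AnalyticAt ℂ g π := fun π h =>
    AnalyticAt.comp ((ContinuousMap.evalCLM ℂ (1 : I) : C(I, ℂ) →L[ℂ] ℂ).analyticAt (Z π)) h
  have hg0 : g (0, b) = m₀ := by simp [hg, hZ0]
  obtain ⟨δ, hδ, hδu⟩ := Metric.eventually_nhds_iff.1 hZuniq
  have hclose : ∀ᶠ π in 𝓝 ((0 : ℂ), b), dist (Z π) (constIncl m₀) < δ := by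
    have := hZ.continuousAt.eventually (Metric.ball_mem_nhds _ hδ)
    rwa [hZ0] at this
  have hclose' : ∀ᶠ π in 𝓝 ((0 : ℂ), b), ‖g π - m₀‖ < ‖m₀‖ := by
    have := (hev _ hZ).continuousAt.eventually (Metric.ball_mem_nhds _ (norm_pos_iff.2 hm₀0))
    simpa only [hg0, Metric.mem_ball, dist_eq_norm] using this
  obtain ⟨e, he, hball⟩ := Metric.eventually_nhds_iff.1
    (hZeq.and (hZ.eventually_analyticAt.and (hclose'.and (hclose.and
      (Metric.ball_mem_nhds ((0 : ℂ), b) hδ)))))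
  have hmem : ∀ w ξ, ‖w‖ < e → dist ξ b < e → dist (w, ξ) ((0 : ℂ), b) < e := by
    intro w ξ h1 h2
    simp only [Prod.dist_eq, dist_zero_right, max_lt_iff]
    exact ⟨h1, h2⟩
  have hscale : ∀ w ξ, ‖w‖ < e → dist ξ b < e → ∀ t : I,
      Z ((t : ℝ) * w, ξ) = rescale t (Z (w, ξ)) := by
    intro w ξ h1 h2 t
    have ht := mul_mem_ball_zero (mem_ball_zero_iff.2 h1) t
    rw [mem_ball_zero_iff] at ht
    have hb := hball (hmem w ξ h1 h2)
    have hb' := hball (hmem _ ξ ht h2)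
    refine (@hδu (((t : ℝ) * w, ξ), rescale t (Z (w, ξ))) ?_ ?_).symm
    · rw [Prod.dist_eq, max_lt_iff]
      refine ⟨hb'.2.2.2.2, lt_of_le_of_lt ?_ hb.2.2.2.1⟩
      exact dist_rescale_const_le _ _ _
    · rw [leafIntegralEq_rescale, hb.1]
      ext; simp
  refine ⟨g, e, he, by rwa [hg0], fun w hw ξ hξ => ?_⟩
  have hw' := mem_ball_zero_iff.1 hw
  have hb := hball (hmem w ξ hw' hξ)
  refine ⟨hev _ hb.2.1, by rw [hg0]; exact hb.2.2.1, ?_⟩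
  have hgl : ∀ w ∈ Metric.ball (0 : ℂ) e, AnalyticAt ℂ (fun w => g (w, ξ)) w := fun w hw =>
    (hev _ (hball (hmem w ξ (mem_ball_zero_iff.1 hw) hξ)).2.1).comp (g := g)
      (f := fun w => (w, ξ)) (by fun_prop)
  have hgn : ∀ w ∈ Metric.ball (0 : ℂ) e, AnalyticAt ℂ (fun w => w * g (w, ξ)) w := fun w hw =>
    analyticAt_id.mul (hgl w hw)
  -- Multiplying the integral equation by `w²` shows that `v²` is a radial integral; its derivative
  -- `2 v v'` is twice the leaf equation.
  have hsq : HasDerivAt (fun w => (w * g (w, ξ)) ^ 2)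
      (-4 * w * leafField p q w ξ (w * g (w, ξ))) w := by
    refine hasDerivAt_of_eq_radial_integral (C := 0) (r := e)
      (k := fun w => -4 * w * leafField p q w ξ (w * g (w, ξ))) ?_ ?_ hw
    · intro w hw
      have : AnalyticAt ℂ (fun w => leafField p q w ξ (w * g (w, ξ))) w :=
        AnalyticAt.leafField_comp analyticAt_id (hgn w hw)
      exact ((by fun_prop : AnalyticAt ℂ (fun w => -4 * w * leafField p q w ξ (w * g (w, ξ))) w)
        ).differentiableAt.differentiableWithinAt
    · intro w hw
      have hw' := mem_ball_zero_iff.1 hw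
      have h := DFunLike.congr_fun (hball (hmem w ξ hw' hξ)).1 1
      rw [leafIntegralEq_apply, ContinuousMap.zero_apply] at h
      simp only [one_mul, Set.Icc.coe_one, Complex.ofReal_one] at h
      have h2 : g (w, ξ) ^ 2 = -4 * ∫ u : I, ((u : ℝ) : ℂ) *
          leafField p q (w * (u : ℝ)) ξ (w * (u : ℝ) * Z (w, ξ) u) := by
        linear_combination h
      have h3 : ∀ u : I, g ((u : ℝ) * w, ξ) = Z (w, ξ) u := fun u => by
        simp only [hg]
        rw [hscale w ξ hw' hξ u, rescale_apply, mul_one]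
      have h4 : ∀ u : I, -4 * (((u : ℝ) : ℂ) * w) * leafField p q ((u : ℝ) * w) ξ ((u : ℝ) * w *
          g ((u : ℝ) * w, ξ)) = (-4 * w) * (((u : ℝ) : ℂ) *
          leafField p q (w * (u : ℝ)) ξ (w * (u : ℝ) * Z (w, ξ) u)) := fun u => by
        rw [h3, mul_comm w]; ring
      simp only [h4]
      rw [MeasureTheory.integral_const_mul, mul_pow, h2]
      ring
  have h1 := (hgn w hw).differentiableAt.hasDerivAt
  have h2 := (h1.pow 2).unique hsq
  simp only [Nat.cast_ofNat, Nat.add_one_sub_one, pow_one] at h2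
  linear_combination h2 / 2

/-! ### Uniqueness and gluing of analytic continuations -/

/-- Near a point of analyticity, agreement of germs at a point does not depend on the point. -/
theorem AnalyticAt.eventually_eventuallyEq_iff {g h : ℂ → ℂ} {z : ℂ} (hg : AnalyticAt ℂ g z)
    (hh : AnalyticAt ℂ h z) : ∀ᶠ z' in 𝓝 z, (g =ᶠ[𝓝 z'] h ↔ g =ᶠ[𝓝 z] h) := by
  by_cases hgh : g =ᶠ[𝓝 z] h
  · filter_upwards [hgh.eventually_nhds] with z' hz'
    exact iff_of_true hz' hgh
  -- Isolated zeros: if the germs differ at `z`, then `g - h` has no zero near `z` except possibly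
  -- `z`, so it vanishes on no small open set.
  rcases (hg.sub hh).eventually_eq_zero_or_eventually_ne_zero with h0 | h0
  · exact absurd (h0.mono fun x hx => sub_eq_zero.1 hx) hgh
  rw [eventually_nhdsWithin_iff] at h0
  filter_upwards [h0.eventually_nhds] with z' hz'
  refine iff_of_false (fun hE => ?_) hgh
  have h1 : ∀ᶠ x in 𝓝 z', x = z := by
    filter_upwards [hz', hE] with x hx hx'
    by_contra hne
    exact hx hne (sub_eq_zero.2 hx')
  have h2 : z' = z := h1.self_of_nhds
  subst h2
  exact (NeBot.ne' : (𝓝[≠] z') ≠ ⊥) (by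
    rw [← Filter.empty_mem_iff_bot]
    filter_upwards [h1.filter_mono nhdsWithin_le_nhds, self_mem_nhdsWithin] with x hx hx'
    exact hx' hx)

/-- The truth value of `Q` is locally constant on a connected set. This transports both equality of
germs and validity of the differential equation along a path. -/
theorem IsPreconnected.iff_of_locally_iff {X : Type*} [TopologicalSpace X] {J : Set X}
    (hJ : IsPreconnected J) {Q : X → Prop} (h : ∀ t ∈ J, ∀ᶠ t' in 𝓝[J] t, (Q t' ↔ Q t))
    {t₀ t : X} (h₀ : t₀ ∈ J) (ht : t ∈ J) : Q t₀ ↔ Q t :=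
  hJ.induction₂ (fun x y => Q x ↔ Q y) (fun x hx => (h x hx).mono fun _ hy => hy.symm)
    (fun _ _ _ _ _ _ => Iff.trans) (fun _ _ _ _ => Iff.symm) h₀ ht

section Continuation

variable {a b : ℂ} {s : Path a b} {J : Set I} {f g : I → ℂ → ℂ}

theorem IsAnalyticContinuation.mono {K : Set I} (hf : IsAnalyticContinuation s J f)
    (hK : K ⊆ J) : IsAnalyticContinuation s K f := fun t ht =>
  ⟨(hf t (hK ht)).1, (hf t (hK ht)).2.filter_mono (nhdsWithin_mono _ hK)⟩

theorem isAnalyticContinuation_const {h : ℂ → ℂ} (hh : ∀ t ∈ J, AnalyticAt ℂ h (s t)) :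
    IsAnalyticContinuation s J fun _ => h := fun t ht =>
  ⟨hh t ht, Eventually.of_forall fun _ => EventuallyEq.rfl⟩

theorem Path.eventually_comp {P : ℂ → Prop} {t : I} (h : ∀ᶠ z in 𝓝 (s t), P z) :
    ∀ᶠ t' in 𝓝[J] t, P (s t') :=
  (s.continuous.continuousAt.eventually h).filter_mono nhdsWithin_le_nhds

/-- Analytic continuation along a path is unique. -/
theorem IsAnalyticContinuation.unique (hf : IsAnalyticContinuation s J f)
    (hg : IsAnalyticContinuation s J g) (hJ : IsPreconnected J) {t₀ t : I} (h₀ : t₀ ∈ J)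
    (ht : t ∈ J) (h : f t₀ =ᶠ[𝓝 (s t₀)] g t₀) : f t =ᶠ[𝓝 (s t)] g t := by
  refine (hJ.iff_of_locally_iff (Q := fun t => f t =ᶠ[𝓝 (s t)] g t) (fun t ht => ?_) h₀ ht).1 h
  filter_upwards [(hf t ht).2, (hg t ht).2,
    Path.eventually_comp ((hf t ht).1.eventually_eventuallyEq_iff (hg t ht).1)] with t' h1 h2 h3
  rw [← h3]
  exact ⟨fun h => (h1.symm.trans h).trans h2, fun h => (h1.trans h).trans h2.symm⟩

theorem IsAnalyticContinuation.continuousOn_value (hf : IsAnalyticContinuation s J f) :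
    ContinuousOn (fun t => f t (s t)) J := fun t ht => by
  have h1 : ContinuousWithinAt (fun t' => f t (s t')) J t :=
    ((hf t ht).1.continuousAt.comp s.continuous.continuousAt).continuousWithinAt
  refine h1.congr_of_eventuallyEq ?_ rfl
  filter_upwards [(hf t ht).2] with t' h using h.self_of_nhds

open Classical in
/-- Concatenation of analytic continuations along consecutive parts of a path. -/
theorem IsAnalyticContinuation.glue {c d : I} (hcd : c ≤ d)
    (hf : IsAnalyticContinuation s (Iic c) f) (hg : IsAnalyticContinuation s (Icc c d) g)
    (h : f c =ᶠ[𝓝 (s c)] g c) :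
    ∃ F : I → ℂ → ℂ, IsAnalyticContinuation s (Iic d) F ∧ (∀ t ≤ c, F t = f t) ∧
      F d =ᶠ[𝓝 (s d)] g d := by
  refine ⟨fun t => if t ≤ c then f t else g t, fun t ht => ?_, fun t ht => if_pos ht, ?_⟩
  · rcases lt_trichotomy t c with htc | rfl | htc
    · simp only [htc.le, if_true]
      refine ⟨(hf t htc.le).1, ?_⟩
      have h1 := (hf t htc.le).2
      rw [nhdsWithin_eq_nhds.2 (Iic_mem_nhds htc)] at h1
      filter_upwards [h1.filter_mono nhdsWithin_le_nhds,
        nhdsWithin_le_nhds (Iio_mem_nhds htc)] with t' h2 h3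
      rw [if_pos (le_of_lt h3)]
      exact h2
    · simp only [le_refl, if_true]
      refine ⟨(hf t self_mem_Iic).1, ?_⟩
      have h1 := (hf t self_mem_Iic).2
      have h2 := (hg t ⟨le_rfl, hcd⟩).2
      rw [eventually_nhdsWithin_iff] at h1 h2 ⊢
      filter_upwards [h1, h2, s.continuous.continuousAt.eventually h.eventually_nhds]
        with t' h3 h4 h5 h6
      split_ifs with h7
      · exact h3 h7
      · exact (h4 ⟨(not_le.1 h7).le, h6⟩).trans (EventuallyEq.symm h5)
    · simp only [not_le.2 htc, if_false]
      refine ⟨(hg t ⟨htc.le, ht⟩).1, ?_⟩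
      have h1 := (hg t ⟨htc.le, ht⟩).2
      rw [eventually_nhdsWithin_iff] at h1 ⊢
      filter_upwards [h1, Ioi_mem_nhds htc] with t' h2 h3 h4
      rw [if_neg (not_le.2 h3)]
      exact h2 ⟨le_of_lt h3, h4⟩
  · simp only
    split_ifs with h1
    · obtain rfl := le_antisymm h1 hcd
      exact h
    · exact EventuallyEq.rfl

end Continuation

/-- Propagation of a property along the unit interval by uniform local steps. -/
theorem unitInterval.induction_of_local_step {S : I → Prop} {C : I} (h0 : S 0)
    (hloc : ∀ t ≤ C, ∃ O ∈ 𝓝 t, ∀ t' ∈ O, ∀ t'' ∈ O, t' ≤ t'' → t'' ≤ C → S t' → S t'') : S C := by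
  have hloc' : ∀ t : Iic C, ∃ O : Set I, IsOpen O ∧ (t : I) ∈ O ∧
      ∀ t' ∈ O, ∀ t'' ∈ O, t' ≤ t'' → t'' ≤ C → S t' → S t'' := by
    rintro ⟨t, ht⟩
    obtain ⟨O, hO, h⟩ := hloc t ht
    obtain ⟨U, hUO, hU, htU⟩ := mem_nhds_iff.1 hO
    exact ⟨U, hU, htU, fun t' h1 t'' h2 => h t' (hUO h1) t'' (hUO h2)⟩
  choose O hO htO hstep using hloc'
  -- Pulling back under `x ↦ min x C` turns a cover of `Iic C` into a cover of the whole interval,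
  -- which has a finite monotone subdivision.
  obtain ⟨τ, hτ0, hτm, ⟨n, hn⟩, hτ⟩ := exists_monotone_Icc_subset_open_cover_unitInterval
    (c := fun t : Iic C => (fun x : I => min x C) ⁻¹' O t)
    (fun t => (hO t).preimage (by fun_prop))
    (fun t _ => mem_iUnion.2 ⟨⟨min t C, mem_Iic.2 (min_le_right _ _)⟩, htO _⟩)
  have key : ∀ k, S (min (τ k) C) := by
    intro k
    induction k with
    | zero => rw [hτ0, min_eq_left (show (0 : I) ≤ C from C.2.1)]; exact h0
    | succ k ih =>
      obtain ⟨i, hi⟩ := hτ k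
      have hk := hτm (Nat.le_succ k)
      exact hstep i _ (hi ⟨le_rfl, hk⟩) _ (hi ⟨hk, le_rfl⟩) (min_le_min_right _ hk)
        (min_le_right _ _) ih
  have := key n
  rwa [hn n le_rfl, min_eq_right (show C ≤ (1 : I) from C.2.2)] at this

/-! ### Germs of solutions and their continuation -/

/-- `g` solves the Abel equation near `z`. -/
def SolvesAbelNear (p q : Polynomial ℂ) (z : ℂ) (g : ℂ → ℂ) : Prop :=
  ∀ᶠ x in 𝓝 z, HasDerivAt g (abelField p q x (g x)) x

section Solution

variable {p q : Polynomial ℂ} {g h : ℂ → ℂ} {z : ℂ}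

theorem SolvesAbelNear.analyticAt (hg : SolvesAbelNear p q z g) : AnalyticAt ℂ g z :=
  Complex.analyticAt_iff_eventually_differentiableAt.2 (hg.mono fun _ hx => hx.differentiableAt)

theorem SolvesAbelNear.congr (hg : SolvesAbelNear p q z g) (hgh : g =ᶠ[𝓝 z] h) :
    SolvesAbelNear p q z h := by
  filter_upwards [hg, hgh.eventuallyEq_nhds] with x hx hx'
  rw [← hx'.eq_of_nhds]
  exact hx.congr_of_eventuallyEq hx'.symm

theorem solvesAbelNear_congr (hgh : g =ᶠ[𝓝 z] h) :
    SolvesAbelNear p q z g ↔ SolvesAbelNear p q z h :=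
  ⟨fun hg => hg.congr hgh, fun hh => hh.congr hgh.symm⟩

theorem solvesAbelNear_iff (hg : AnalyticAt ℂ g z) :
    SolvesAbelNear p q z g ↔ deriv g =ᶠ[𝓝 z] fun x => abelField p q x (g x) := by
  refine ⟨fun h => h.mono fun x hx => hx.deriv, fun h => ?_⟩
  filter_upwards [h, hg.eventually_analyticAt] with x hx hx'
  rw [← hx]
  exact hx'.differentiableAt.hasDerivAt

/-- Both sides of the differential equation are analytic near `z`, so their agreement as germs is
locally constant. -/
theorem AnalyticAt.eventually_solvesAbelNear_iff (hg : AnalyticAt ℂ g z) :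
    ∀ᶠ z' in 𝓝 z, (SolvesAbelNear p q z' g ↔ SolvesAbelNear p q z g) := by
  have h1 : AnalyticAt ℂ (fun x => abelField p q x (g x)) z := AnalyticAt.abelField_comp analyticAt_id hg
  filter_upwards [hg.eventually_analyticAt, hg.deriv.eventually_eventuallyEq_iff h1] with z' h2 h3
  rw [solvesAbelNear_iff hg, solvesAbelNear_iff h2, h3]

/-- Local uniqueness of solutions of the Abel equation. -/
theorem SolvesAbelNear.unique (hg : SolvesAbelNear p q z g) (hh : SolvesAbelNear p q z h)
    (hz : g z = h z) : g =ᶠ[𝓝 z] h := by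
  have ha := hg.analyticAt
  have hb := hh.analyticAt
  have hk := ha.sub hb
  set A : ℂ → ℂ := fun x => p.eval x * (g x + h x) + q.eval x * (g x ^ 2 + g x * h x + h x ^ 2)
    with hA
  have hAa : AnalyticAt ℂ A z := by
    have hp := (analyticAt_id (𝕜 := ℂ) (z := z)).aeval_polynomial p
    have hq := (analyticAt_id (𝕜 := ℂ) (z := z)).aeval_polynomial q
    simp only [Polynomial.coe_aeval_eq_eval, id_eq] at hp hq
    fun_prop
  have hd : deriv (g - h) =ᶠ[𝓝 z] (g - h) * A := by
    filter_upwards [hg, hh] with x h1 h2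
    rw [(h1.sub h2).deriv]
    simp only [Pi.mul_apply, Pi.sub_apply, abelField, hA]
    ring
  -- The difference `k = g - h` satisfies `k' = k A`. Differentiation lowers a finite positive order
  -- of vanishing by one, multiplication by `A` never lowers it; so the order of `k` is infinite.
  have h1 := hk.analyticOrderAt_deriv_add_one
  rw [analyticOrderAt_congr hd, analyticOrderAt_mul hk hAa] at h1
  have h2 : (fun x => (g - h) x - (g - h) z) = g - h := by
    ext x; simp [hz]
  rw [h2] at h1
  have h3 : analyticOrderAt (g - h) z = ⊤ := by
    by_contra hne
    have h4 := (ENat.add_one_le_iff hne).1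
      (h1.le.trans' (add_le_add_left (le_self_add (a := analyticOrderAt (g - h) z)) 1))
    exact lt_irrefl _ h4
  exact (analyticOrderAt_eq_top.1 h3).mono fun x hx => sub_eq_zero.1 hx

variable {a b : ℂ} {s : Path a b} {J : Set I} {f : I → ℂ → ℂ} {y : ℂ}

theorem IsAnalyticContinuation.solvesAbelNear (hf : IsAnalyticContinuation s J f)
    (hJ : IsPreconnected J) {t₀ t : I} (h₀ : t₀ ∈ J) (ht : t ∈ J)
    (h : SolvesAbelNear p q (s t₀) (f t₀)) : SolvesAbelNear p q (s t) (f t) := by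
  refine (hJ.iff_of_locally_iff (Q := fun t => SolvesAbelNear p q (s t) (f t))
    (fun t ht => ?_) h₀ ht).1 h
  filter_upwards [(hf t ht).2, Path.eventually_comp (hf t ht).1.eventually_solvesAbelNear_iff]
    with t' h1 h2
  rw [solvesAbelNear_congr h1, h2]

theorem SolutionContinues.solvesAbelNear (hf : SolutionContinues p q s J y f)
    (hJ : IsPreconnected J) (h0 : 0 ∈ J) {t : I} (ht : t ∈ J) : SolvesAbelNear p q (s t) (f t) := by
  refine hf.2.solvesAbelNear hJ h0 ht ?_
  rw [s.source]
  exact hf.1.2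

theorem SolutionContinues.unique {g : I → ℂ → ℂ} (hf : SolutionContinues p q s J y f)
    (hg : SolutionContinues p q s J y g) (hJ : IsPreconnected J) (h0 : 0 ∈ J) {t : I}
    (ht : t ∈ J) : f t =ᶠ[𝓝 (s t)] g t := by
  refine hf.2.unique hg.2 hJ h0 ht ?_
  rw [s.source]
  exact SolvesAbelNear.unique hf.1.2 hg.1.2 (hf.1.1.trans hg.1.1.symm)

theorem SolutionContinues.mono {K : Set I} (hf : SolutionContinues p q s J y f) (hK : K ⊆ J) :
    SolutionContinues p q s K y f := ⟨hf.1, hf.2.mono hK⟩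

theorem SolutionContinues.glue {c d : I} {g : I → ℂ → ℂ} (hcd : c ≤ d)
    (hf : SolutionContinues p q s (Iic c) y f) (hg : IsAnalyticContinuation s (Icc c d) g)
    (h : f c =ᶠ[𝓝 (s c)] g c) :
    ∃ F, SolutionContinues p q s (Iic d) y F ∧ F d =ᶠ[𝓝 (s d)] g d := by
  obtain ⟨F, h1, h2, h3⟩ := hf.2.glue hcd hg h
  refine ⟨F, ⟨?_, h1⟩, h3⟩
  rw [h2 0 c.2.1]
  exact hf.1

end Solution

/-! ### Dependence on the initial value and blow-up -/

section Dependence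

variable {p q : Polynomial ℂ} {a b : ℂ} {s : Path a b} {f : I → ℂ → ℂ} {y₁ : ℂ}

theorem zero_mem_Iic_unitInterval (c : I) : (0 : I) ∈ Iic c := c.2.1

/-- A solution extends a continuation along an initial part of a path as far as it is defined. -/
theorem SolutionContinues.extend_by_solution {c d : I} {x : ℂ} {ε : ℝ} {g : ℂ → ℂ} (hcd : c ≤ d)
    (hf : SolutionContinues p q s (Iic c) y₁ f) (hs : ∀ t ∈ Icc c d, s t ∈ Metric.ball x ε)
    (hg : ∀ z ∈ Metric.ball x ε, HasDerivAt g (abelField p q z (g z)) z)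
    (h : f c (s c) = g (s c)) :
    ∃ F, SolutionContinues p q s (Iic d) y₁ F ∧ F d =ᶠ[𝓝 (s d)] g := by
  have hsol : ∀ t ∈ Icc c d, SolvesAbelNear p q (s t) g := fun t ht =>
    (Metric.isOpen_ball.eventually_mem (hs t ht)).mono hg
  refine hf.glue hcd (isAnalyticContinuation_const fun t ht => (hsol t ht).analyticAt) ?_
  exact (hf.solvesAbelNear isPreconnected_Iic (zero_mem_Iic_unitInterval c) self_mem_Iic).unique
    (hsol c ⟨le_rfl, hcd⟩) h

/-- The value at the end of a continuation depends biholomorphically on the initial value. -/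
theorem SolutionContinues.exists_analytic_dependence {C : I}
    (hf : SolutionContinues p q s (Iic C) y₁ f) :
    ∃ Y : ℂ → ℂ, AnalyticAt ℂ Y y₁ ∧ deriv Y y₁ ≠ 0 ∧ Y y₁ = f C (s C) ∧
      ∀ᶠ y in 𝓝 y₁, ∃ F, SolutionContinues p q s (Iic C) y F ∧ F C (s C) = Y y := by
  refine unitInterval.induction_of_local_step (C := C) (S := fun c => ∃ Y : ℂ → ℂ,
    AnalyticAt ℂ Y y₁ ∧ deriv Y y₁ ≠ 0 ∧ Y y₁ = f c (s c) ∧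
      ∀ᶠ y in 𝓝 y₁, ∃ F, SolutionContinues p q s (Iic c) y F ∧ F c (s c) = Y y) ?_ fun t ht => ?_
  · refine ⟨id, analyticAt_id, by simp, ?_, ?_⟩
    · rw [s.source]; exact hf.1.1.symm
    obtain ⟨ε, hε, u, hu⟩ := exists_uniform_abel_flow p q a y₁
    filter_upwards [Metric.ball_mem_nhds y₁ hε] with y hy
    have ha := Metric.mem_ball_self (x := a) hε
    have hsol : SolvesAbelNear p q a (u a y) :=
      Eventually.mono (Metric.ball_mem_nhds a hε) fun x hx => ((hu a ha y hy).2 x hx).1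
    refine ⟨fun _ => u a y, ⟨⟨(hu a ha y hy).1, hsol⟩, isAnalyticContinuation_const ?_⟩, ?_⟩
    · intro t ht
      obtain rfl : t = 0 := le_antisymm ht t.2.1
      rw [s.source]
      exact hsol.analyticAt
    · rw [s.source]; exact (hu a ha y hy).1
  · obtain ⟨ε, hε, u, hu⟩ := exists_uniform_abel_flow p q (s t) (f t (s t))
    have h1 := s.continuous.continuousAt.eventually (Metric.ball_mem_nhds (s t) hε)
    have h2 : ∀ᶠ t' in 𝓝 t, t' ∈ Iic C → f t' (s t') ∈ Metric.ball (f t (s t)) ε :=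
      eventually_nhdsWithin_iff.1 (hf.2.continuousOn_value t ht (Metric.ball_mem_nhds _ hε))
    obtain ⟨δ, hδ, hball⟩ := Metric.eventually_nhds_iff.1 (h1.and h2)
    refine ⟨Metric.ball t δ, Metric.ball_mem_nhds t hδ, ?_⟩
    rintro t' ht' t'' ht'' hle hC ⟨Y, hY, hY', hY1, hYF⟩
    have hIcc : ∀ x ∈ Icc t' t'', s x ∈ Metric.ball (s t) ε := by
      intro x hx
      refine (hball ?_).1
      have h3 : ((t' : ℝ)) ≤ x := hx.1
      have h4 : (x : ℝ) ≤ t'' := hx.2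
      rw [Metric.mem_ball, Subtype.dist_eq, Real.dist_eq, abs_lt] at ht' ht''
      rw [Subtype.dist_eq, Real.dist_eq, abs_lt]
      exact ⟨by linarith, by linarith⟩
    have hst' := hIcc t' ⟨le_rfl, hle⟩
    have hst'' := hIcc t'' ⟨hle, le_rfl⟩
    have hYb : Y y₁ ∈ Metric.ball (f t (s t)) ε := by
      rw [hY1]; exact (hball ht').2 (hle.trans hC)
    obtain ⟨hu1, hu2⟩ := hu _ hst' _ hYb
    obtain ⟨-, hu4, hu5⟩ := hu2 _ hst''
    -- The dependence up to `t''` is that up to `t'` followed by the local flow; the chain rule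
    -- keeps the derivative nonzero.
    refine ⟨fun y => u (s t') (Y y) (s t''), ?_, ?_, ?_, ?_⟩
    · exact hu4.comp (g := fun v => u (s t') v (s t'')) hY
    · have := deriv_comp y₁ hu4.differentiableAt hY.differentiableAt
      change deriv ((fun v => u (s t') v (s t'')) ∘ Y) y₁ ≠ 0
      rw [this]
      exact mul_ne_zero hu5 hY'
    · obtain ⟨F, hF1, hF2⟩ := (hf.mono (Iic_subset_Iic.2 (hle.trans hC))).extend_by_solution hle
        hIcc (fun z hz => (hu2 z hz).1) (by rw [hu1, hY1])
      refine hF2.eq_of_nhds.symm.trans ?_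
      exact (hF1.unique (hf.mono (Iic_subset_Iic.2 hC)) isPreconnected_Iic
        (zero_mem_Iic_unitInterval _) self_mem_Iic).eq_of_nhds
    · filter_upwards [hYF, hY.continuousAt.eventually (Metric.isOpen_ball.mem_nhds hYb)]
        with y hy hyb
      obtain ⟨F, hF, hFY⟩ := hy
      obtain ⟨hv1, hv2⟩ := hu _ hst' _ hyb
      obtain ⟨F', hF1, hF2⟩ := hF.extend_by_solution hle hIcc (fun z hz => (hv2 z hz).1)
        (by rw [hv1, hFY])
      exact ⟨F', hF1, hF2.eq_of_nhds⟩

/-- A solution that continues along a path up to, but not including, its end, is unbounded there. -/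
theorem SolutionContinues.tendsto_norm_atTop (hf : SolutionContinues p q s (Iio 1) y₁ f)
    (hsing : ¬ ∃ f : I → ℂ → ℂ, SolutionContinues p q s univ y₁ f) :
    Tendsto (fun t => ‖f t (s t)‖) (𝓝[<] 1) atTop := by
  rw [tendsto_atTop]
  by_contra! hM
  obtain ⟨M, hM⟩ := hM
  -- Without blow-up the values accumulate at some `η`. The flow near `(b, η)` lives on a disk of
  -- uniform radius, so from a late time with value near `η` it carries the solution through `b`.
  obtain ⟨η, -, hη⟩ := (isCompact_closedBall (0 : ℂ) M).exists_mapClusterPt_of_frequently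
    (f := fun t => f t (s t)) (l := 𝓝[<] (1 : I)) (hM.mono fun t ht =>
      mem_closedBall_zero_iff.2 ht.le)
  obtain ⟨ε, hε, u, hu⟩ := exists_uniform_abel_flow p q b η
  have h1 := s.continuous.continuousAt.eventually (Metric.ball_mem_nhds (s 1) hε)
  obtain ⟨δ, hδ, hball⟩ := Metric.eventually_nhds_iff.1 h1
  obtain ⟨t, ht1, ht2, ht3⟩ := ((hη.frequently (Metric.ball_mem_nhds η hε)).and_eventually
    ((eventually_nhdsWithin_of_eventually_nhds (Metric.ball_mem_nhds 1 hδ)).and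
      (self_mem_nhdsWithin (s := Iio (1 : I))))).exists
  have hIcc : ∀ x ∈ Icc t 1, s x ∈ Metric.ball b ε := by
    intro x hx
    rw [Metric.mem_ball]
    refine lt_of_eq_of_lt (congrArg _ s.target.symm) (@hball x ?_)
    have h3 : ((t : ℝ)) ≤ x := hx.1
    have h4 : (x : ℝ) ≤ 1 := x.2.2
    rw [Subtype.dist_eq, Real.dist_eq, abs_lt] at ht2
    rw [Subtype.dist_eq, Real.dist_eq, abs_lt]
    simp only [Icc.coe_one] at ht2 ⊢
    exact ⟨by linarith, by linarith⟩
  obtain ⟨hu1, hu2⟩ := hu _ (hIcc t ⟨le_rfl, ht3.le⟩) _ ht1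
  obtain ⟨F, hF, -⟩ := (hf.mono (Iic_subset_Iio.2 ht3)).extend_by_solution (le_of_lt ht3) hIcc
    (fun z hz => (hu2 z hz).1) hu1.symm
  refine hsing ⟨F, hF.mono fun t _ => ?_⟩
  exact t.2.2

end Dependence

/-! ### Square roots along paths -/

/-- The branch of the square root near `w ^ 2` with value `w` at `w ^ 2`. -/
noncomputable def sqrtBranch (w z : ℂ) : ℂ := w * (z / w ^ 2) ^ (1 / 2 : ℂ)

theorem sqrtBranch_sq {w : ℂ} (hw : w ≠ 0) (z : ℂ) : sqrtBranch w z ^ 2 = z := by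
  have h : ((z / w ^ 2) ^ (1 / 2 : ℂ)) ^ 2 = z / w ^ 2 := by
    rw [one_div]
    exact Complex.cpow_ofNat_inv_pow (z / w ^ 2) 2
  rw [sqrtBranch, mul_pow, h, mul_div_cancel₀ _ (pow_ne_zero 2 hw)]

theorem sqrtBranch_self {w : ℂ} (hw : w ≠ 0) : sqrtBranch w (w ^ 2) = w := by
  rw [sqrtBranch, div_self (pow_ne_zero 2 hw), Complex.one_cpow, mul_one]

theorem analyticAt_sqrtBranch {w : ℂ} (hw : w ≠ 0) : AnalyticAt ℂ (sqrtBranch w) (w ^ 2) := by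
  unfold sqrtBranch
  refine analyticAt_const.mul (AnalyticAt.cpow (analyticAt_id.div analyticAt_const
    (pow_ne_zero 2 hw)) analyticAt_const ?_)
  rw [div_self (pow_ne_zero 2 hw)]
  exact Complex.one_mem_slitPlane

/-- The sum tends to `2 w ≠ 0`, which excludes opposite signs. -/
theorem eventually_eq_of_sq_eq {X : Type*} {l : Filter X} {β₁ β₂ : X → ℂ} {w : ℂ} (hw : w ≠ 0)
    (h₁ : Tendsto β₁ l (𝓝 w)) (h₂ : Tendsto β₂ l (𝓝 w)) (h : ∀ᶠ x in l, β₁ x ^ 2 = β₂ x ^ 2) :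
    β₁ =ᶠ[l] β₂ := by
  have h3 : ∀ᶠ x in l, β₁ x + β₂ x ≠ 0 := by
    refine (h₁.add h₂).eventually_ne ?_
    rw [← two_mul]
    exact mul_ne_zero two_ne_zero hw
  filter_upwards [h, h3] with x hx hx'
  rcases sq_eq_sq_iff_eq_or_eq_neg.1 hx with h4 | h4
  · exact h4
  · exact absurd (by rw [h4]; ring) hx'

theorem analyticAt_sqrtBranch_sub {w x ξ : ℂ} (hw : w ≠ 0) (h : w ^ 2 = x - ξ) :
    AnalyticAt ℂ (fun z => sqrtBranch w (z - ξ)) x := by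
  refine AnalyticAt.comp (g := sqrtBranch w) (f := fun z => z - ξ) ?_ (by fun_prop)
  rw [← h]
  exact analyticAt_sqrtBranch hw

theorem tendsto_sqrtBranch_sub {w x ξ : ℂ} (hw : w ≠ 0) (h : w ^ 2 = x - ξ) :
    Tendsto (fun z => sqrtBranch w (z - ξ)) (𝓝 x) (𝓝 w) := by
  have h1 := (analyticAt_sqrtBranch_sub hw h).continuousAt.tendsto
  rwa [← h, sqrtBranch_self hw] at h1

/-- A continuous choice of `√(s t - ξ)` yields an analytic continuation of `k (√(z - ξ))`. -/
theorem isAnalyticContinuation_comp_sqrtBranch {a b : ℂ} {s : Path a b} {J : Set I} {ζ : I → ℂ}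
    {ξ : ℂ} {k : ℂ → ℂ} (hζ : ContinuousOn ζ J) (h0 : ∀ t ∈ J, ζ t ≠ 0)
    (hsq : ∀ t ∈ J, ζ t ^ 2 = s t - ξ) (hk : ∀ t ∈ J, AnalyticAt ℂ k (ζ t)) :
    IsAnalyticContinuation s J fun t z => k (sqrtBranch (ζ t) (z - ξ)) := by
  intro t ht
  have ha := analyticAt_sqrtBranch_sub (h0 t ht) (hsq t ht)
  have hl := tendsto_sqrtBranch_sub (h0 t ht) (hsq t ht)
  refine ⟨?_, ?_⟩
  · refine AnalyticAt.comp (g := k) ?_ ha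
    rw [← hsq t ht, sqrtBranch_self (h0 t ht)]
    exact hk t ht
  -- The continuous root `ζ` and the analytic branch at `t` have equal squares and the same nonzero
  -- limit, so they coincide near `t`.
  · have h1 : (fun t' => sqrtBranch (ζ t) (s t' - ξ)) =ᶠ[𝓝[J] t] ζ := by
      refine eventually_eq_of_sq_eq (h0 t ht) ?_ (hζ t ht) ?_
      · exact (hl.comp s.continuous.continuousAt).mono_left nhdsWithin_le_nhds
      · filter_upwards [self_mem_nhdsWithin] with t' ht'
        rw [sqrtBranch_sq (h0 t ht), hsq t' ht']
    filter_upwards [h1, self_mem_nhdsWithin, Path.eventually_comp ha.eventually_analyticAt]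
      with t' h2 h3 h4
    have h5 : (fun z => sqrtBranch (ζ t') (z - ξ)) =ᶠ[𝓝 (s t')] fun z => sqrtBranch (ζ t) (z - ξ) := by
      refine eventually_eq_of_sq_eq (h0 t' h3) (tendsto_sqrtBranch_sub (h0 t' h3) (hsq t' h3)) ?_
        (Eventually.of_forall fun z => ?_)
      · rw [← h2]; exact h4.continuousAt.tendsto
      · simp only [sqrtBranch_sq (h0 t ht), sqrtBranch_sq (h0 t' h3)]
    exact h5.fun_comp k

/-- Path lifting for the covering `w ↦ w²` of the punctured plane. -/
theorem exists_continuous_sqrt {τ : I → ℂ} (hτ : Continuous τ) (h0 : ∀ t, τ t ≠ 0) :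
    ∃ ζ : I → ℂ, Continuous ζ ∧ ∀ t, ζ t ^ 2 = τ t := by
  obtain ⟨w, hw⟩ := IsAlgClosed.exists_pow_nat_eq (τ 0) (n := 2) (by norm_num)
  have hw0 : w ≠ 0 := by
    rintro rfl
    exact h0 0 (by rw [← hw]; simp)
  obtain ⟨Γ, hΓ, -⟩ := (isCoveringMap_npow (𝕜 := ℂ) 2 (by norm_num)).exists_path_lifts
    ⟨fun t => ⟨τ t, h0 t⟩, by fun_prop⟩ ⟨w, hw0⟩ (Subtype.ext hw.symm)
  refine ⟨fun t => Γ t, by fun_prop, fun t => ?_⟩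
  exact congrArg Subtype.val (congrFun hΓ t)

/-- Continuous square roots along a part of a path. -/
theorem exists_continuousOn_sqrt {s : I → ℂ} (hs : Continuous s) {c d : I} (hcd : c ≤ d) {ξ w : ℂ}
    (hne : ∀ t ∈ Icc c d, s t ≠ ξ) (hw : w ^ 2 = s c - ξ) :
    ∃ ζ : I → ℂ, Continuous ζ ∧ ζ c = w ∧ ∀ t ∈ Icc c d, ζ t ^ 2 = s t - ξ := by
  -- Clamping the parameter to `[c, d]` keeps the radicand nonzero on the whole interval; the sign
  -- of the root is corrected afterwards.
  obtain ⟨ζ, hζ, hsq⟩ := exists_continuous_sqrt (τ := fun t => s (max c (min t d)) - ξ)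
    (by fun_prop) fun t => sub_ne_zero.2 (hne _ ⟨le_max_left _ _, max_le hcd (min_le_right _ _)⟩)
  have hsq' : ∀ t ∈ Icc c d, ζ t ^ 2 = s t - ξ := fun t ht => by
    rw [hsq, min_eq_left ht.2, max_eq_right ht.1]
  have h1 := hsq' c ⟨le_rfl, hcd⟩
  rw [← hw] at h1
  rcases sq_eq_sq_iff_eq_or_eq_neg.1 h1 with h2 | h2
  · exact ⟨ζ, hζ, h2, hsq'⟩
  · exact ⟨fun t => -ζ t, by fun_prop, neg_eq_iff_eq_neg.2 h2, fun t ht => by rw [neg_sq, hsq' t ht]⟩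

/-! ### Continuation of solutions on leaves -/

/-- `y = 1 / (w m(w, ξ))` with `x = ξ + w ^ 2` parametrizes the solutions of the Abel equation with
large values near `b`, for `w` and `ξ - b` in the disks of radius `δ`. -/
structure IsLeafChart (p q : Polynomial ℂ) (b : ℂ) (m : ℂ × ℂ → ℂ) (δ : ℝ) : Prop where
  pos : 0 < δ
  base_ne_zero : m (0, b) ≠ 0
  analyticAt : ∀ w ∈ Metric.ball (0 : ℂ) δ, ∀ ξ ∈ Metric.ball b δ, AnalyticAt ℂ m (w, ξ)
  norm_sub_lt : ∀ w ∈ Metric.ball (0 : ℂ) δ, ∀ ξ ∈ Metric.ball b δ,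
    ‖m (w, ξ) - m (0, b)‖ < ‖m (0, b)‖
  equation : ∀ w ∈ Metric.ball (0 : ℂ) δ, ∀ ξ ∈ Metric.ball b δ,
    (w * m (w, ξ)) * deriv (fun w => w * m (w, ξ)) w =
      -2 * w * leafField p q w ξ (w * m (w, ξ))

theorem exists_isLeafChart (p q : Polynomial ℂ) {b : ℂ} (hb : q.eval b ≠ 0) :
    ∃ m δ, IsLeafChart p q b m δ := by
  obtain ⟨m, δ, hδ, hm, h⟩ := exists_singular_leaves p q hb
  exact ⟨m, δ, hδ, hm, fun w hw ξ hξ => (h w hw ξ hξ).1, fun w hw ξ hξ => (h w hw ξ hξ).2.1,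
    fun w hw ξ hξ => (h w hw ξ hξ).2.2⟩

/-- The solution on the leaf through the singular point `ξ`, in the uniformizing parameter. -/
noncomputable def leafValue (m : ℂ × ℂ → ℂ) (ξ w : ℂ) : ℂ := (w * m (w, ξ))⁻¹

namespace IsLeafChart

variable {p q : Polynomial ℂ} {b : ℂ} {m : ℂ × ℂ → ℂ} {δ : ℝ} (H : IsLeafChart p q b m δ)
  {w ξ : ℂ}
include H

theorem ne_zero (hw : w ∈ Metric.ball (0 : ℂ) δ) (hξ : ξ ∈ Metric.ball b δ) : m (w, ξ) ≠ 0 := by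
  intro h
  have := H.norm_sub_lt w hw ξ hξ
  rw [h, zero_sub, norm_neg] at this
  exact lt_irrefl _ this

theorem analyticAt_slice (hw : w ∈ Metric.ball (0 : ℂ) δ) (hξ : ξ ∈ Metric.ball b δ) :
    AnalyticAt ℂ (fun w => w * m (w, ξ)) w :=
  analyticAt_id.mul ((H.analyticAt w hw ξ hξ).comp (f := fun w => (w, ξ)) (by fun_prop))

theorem analyticAt_leafValue (hw : w ∈ Metric.ball (0 : ℂ) δ) (hw0 : w ≠ 0)
    (hξ : ξ ∈ Metric.ball b δ) : AnalyticAt ℂ (leafValue m ξ) w :=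
  (H.analyticAt_slice hw hξ).inv (mul_ne_zero hw0 (H.ne_zero hw hξ))

/-- Equality would force `m(w, ξ) + m(-w, ξ) = 0`, but both terms are closer to `m(0, b)` than `0`
is. This separates the two values of the continued Poincaré mapping. -/
theorem leafValue_ne_neg (hw : w ∈ Metric.ball (0 : ℂ) δ) (hw0 : w ≠ 0)
    (hξ : ξ ∈ Metric.ball b δ) : leafValue m ξ w ≠ leafValue m ξ (-w) := by
  intro h
  have hw' : -w ∈ Metric.ball (0 : ℂ) δ := by
    rw [mem_ball_zero_iff] at hw ⊢
    rwa [norm_neg]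
  have h1 := inv_injective h
  have h2 : m (w, ξ) + m (-w, ξ) = 0 := by
    have : w * (m (w, ξ) + m (-w, ξ)) = 0 := by linear_combination h1
    exact (mul_eq_zero.1 this).resolve_left hw0
  have h3 := H.norm_sub_lt w hw ξ hξ
  have h4 := H.norm_sub_lt (-w) hw' ξ hξ
  have h5 : (m (w, ξ) - m (0, b)) + (m (-w, ξ) - m (0, b)) = -(2 * m (0, b)) := by
    linear_combination h2
  have h6 := norm_add_le (m (w, ξ) - m (0, b)) (m (-w, ξ) - m (0, b))
  rw [h5, norm_neg, norm_mul, Complex.norm_two] at h6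
  linarith

/-- For `β = √(z - ξ)` one has `2 β β' = 1`, which cancels the factor `-2 w` of the leaf equation up
to sign and leaves `v v' = -(p v + q)`. -/
theorem solvesAbelNear (hw : w ∈ Metric.ball (0 : ℂ) δ) (hw0 : w ≠ 0) (hξ : ξ ∈ Metric.ball b δ)
    {x : ℂ} (hx : w ^ 2 = x - ξ) :
    SolvesAbelNear p q x fun z => leafValue m ξ (sqrtBranch w (z - ξ)) := by
  have hl := tendsto_sqrtBranch_sub hw0 hx
  filter_upwards [(analyticAt_sqrtBranch_sub hw0 hx).eventually_analyticAt, hl.eventually_ne hw0,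
    hl.eventually (Metric.isOpen_ball.mem_nhds hw)] with z h1 h2 h3
  set β : ℂ → ℂ := fun z => sqrtBranch w (z - ξ) with hβ
  have hsq : ∀ z, β z ^ 2 = z - ξ := fun z => sqrtBranch_sq hw0 _
  have hd := h1.differentiableAt.hasDerivAt
  have hd2 : 2 * β z * deriv β z = 1 := by
    have h4 := hd.pow 2
    have h5 : HasDerivAt (fun z => β z ^ 2) 1 z := by
      simp only [hsq]
      exact (hasDerivAt_id z).sub_const ξ
    simpa using h4.unique h5
  have h2' : β z ≠ 0 := h2
  have hn0 : β z * m (β z, ξ) ≠ 0 := mul_ne_zero h2 (H.ne_zero h3 hξ)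
  have hn := (H.analyticAt_slice h3 hξ).differentiableAt.hasDerivAt
  have heq := H.equation _ h3 ξ hξ
  have hcomp := HasDerivAt.comp z hn hd
  have hfin := hcomp.inv hn0
  have hz : ξ + β z ^ 2 = z := by rw [hsq]; ring
  simp only [leafField] at heq
  change HasDerivAt (fun z => leafValue m ξ (β z)) (abelField p q z (leafValue m ξ (β z))) z
  have heq' : (β z * m (β z, ξ)) * deriv (fun w => w * m (w, ξ)) (β z) =
      -2 * β z * (p.eval z * (β z * m (β z, ξ)) + q.eval z) := by
    have h6 := heq
    change (β z * m (β z, ξ)) * deriv (fun w => w * m (w, ξ)) (β z) =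
      -2 * β z * (p.eval (ξ + β z ^ 2) * (β z * m (β z, ξ)) + q.eval (ξ + β z ^ 2)) at h6
    rwa [hz] at h6
  refine hfin.congr_deriv ?_
  simp only [Function.comp_apply, abelField, leafValue]
  generalize hN : β z * m (β z, ξ) = N at *
  generalize hN' : deriv (fun w => w * m (w, ξ)) (β z) = N' at *
  generalize deriv β z = D at *
  field_simp
  linear_combination (-D) * heq' + (p.eval z * N + q.eval z) * hd2

theorem exists_norm_leafValue_gt (hξ : ξ ∈ Metric.ball b δ) (M : ℝ) :
    ∃ η > 0, ∀ w, w ≠ 0 → ‖w‖ < η → M < ‖leafValue m ξ w‖ := by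
  have h0 : (0 : ℂ) ∈ Metric.ball (0 : ℂ) δ := Metric.mem_ball_self H.pos
  have hc : Tendsto (fun w => w * m (w, ξ)) (𝓝 0) (𝓝 0) := by
    simpa using (H.analyticAt_slice h0 hξ).continuousAt.tendsto
  have h1 : Tendsto (fun w => w * m (w, ξ)) (𝓝[≠] 0) (𝓝[≠] 0) := by
    refine tendsto_nhdsWithin_iff.2 ⟨hc.mono_left nhdsWithin_le_nhds, ?_⟩
    filter_upwards [self_mem_nhdsWithin, nhdsWithin_le_nhds (Metric.isOpen_ball.mem_nhds h0)]
      with w hw hw'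
    exact mul_ne_zero hw (H.ne_zero hw' hξ)
  have h2 := (tendsto_norm_cobounded_atTop.comp
    (Filter.tendsto_inv₀_nhdsNE_zero.comp h1)).eventually_gt_atTop M
  obtain ⟨η, hη, h⟩ := Metric.eventually_nhds_iff.1 (eventually_nhdsWithin_iff.1 h2)
  exact ⟨η, hη, fun w hw hw' => h (by simpa using hw') hw⟩

section Path

variable {a c : ℂ} {s : Path a c} {t₀ t₁ : I}

theorem mem_ball_of_sq_eq {w z : ℂ} (h : w ^ 2 = z - ξ) (hz : ‖z - ξ‖ < δ ^ 2) :
    w ∈ Metric.ball (0 : ℂ) δ := by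
  rw [mem_ball_zero_iff]
  rw [← h, norm_pow] at hz
  exact lt_of_pow_lt_pow_left₀ 2 H.pos.le hz

/-- A solution on a leaf continues along every path that avoids the singular point. -/
theorem exists_continuation (hξ : ξ ∈ Metric.ball b δ) (hle : t₀ ≤ t₁)
    (hs : ∀ t ∈ Icc t₀ t₁, s t ≠ ξ ∧ ‖s t - ξ‖ < δ ^ 2) (hw : w ^ 2 = s t₀ - ξ) :
    ∃ w', w' ^ 2 = s t₁ - ξ ∧ ∃ f : I → ℂ → ℂ, IsAnalyticContinuation s (Icc t₀ t₁) f ∧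
      (f t₀ = fun z => leafValue m ξ (sqrtBranch w (z - ξ))) ∧
      f t₁ = fun z => leafValue m ξ (sqrtBranch w' (z - ξ)) := by
  obtain ⟨ζ, hζ, hζ0, hsq⟩ := exists_continuousOn_sqrt s.continuous hle
    (fun t ht => (hs t ht).1) hw
  have h0 : ∀ t ∈ Icc t₀ t₁, ζ t ≠ 0 := fun t ht h => (hs t ht).1 (by
    have := hsq t ht
    rw [h] at this
    exact (sub_eq_zero.1 (this.symm.trans (by simp))))
  refine ⟨ζ t₁, hsq t₁ ⟨hle, le_rfl⟩, fun t z => leafValue m ξ (sqrtBranch (ζ t) (z - ξ)),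
    isAnalyticContinuation_comp_sqrtBranch hζ.continuousOn h0 hsq fun t ht =>
      H.analyticAt_leafValue (H.mem_ball_of_sq_eq (hsq t ht) (hs t ht).2) (h0 t ht) hξ, ?_, rfl⟩
  simp only [hζ0]

/-- A solution on a leaf does not continue along a path that meets the singular point. -/
theorem ne_of_continuation (hξ : ξ ∈ Metric.ball b δ) {f : I → ℂ → ℂ}
    (hf : IsAnalyticContinuation s (Icc t₀ t₁) f) (hs : ∀ t ∈ Icc t₀ t₁, ‖s t - ξ‖ < δ ^ 2)
    (hw : w ^ 2 = s t₀ - ξ) (hw0 : w ≠ 0)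
    (hfw : f t₀ =ᶠ[𝓝 (s t₀)] fun z => leafValue m ξ (sqrtBranch w (z - ξ))) :
    ∀ t ∈ Icc t₀ t₁, s t ≠ ξ := by
  by_contra! hex
  obtain ⟨t', ht', hst'⟩ := hex
  -- Consider the first time `τ` at which the path meets `ξ`. Before `τ` the continuation must agree
  -- with the leaf, so its values are `leafValue m ξ w'` with `w' → 0`; they are unbounded, against
  -- continuity at `τ`.
  have hcomp : IsCompact (Icc t₀ t₁ ∩ s ⁻¹' {ξ}) :=
    isCompact_Icc.inter_right (isClosed_singleton.preimage s.continuous)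
  obtain ⟨τ, ⟨hτ, hsτ⟩, hmin⟩ := hcomp.exists_isLeast ⟨t', ht', hst'⟩
  have hsτ' : s τ = ξ := hsτ
  have hlt : t₀ < τ := lt_of_le_of_ne hτ.1 (by
    rintro rfl
    rw [hsτ', sub_self] at hw
    exact hw0 (pow_eq_zero_iff two_ne_zero |>.1 hw))
  have hval : ∀ t ∈ Ico t₀ τ, ∃ w', w' ≠ 0 ∧ w' ^ 2 = s t - ξ ∧ f t (s t) = leafValue m ξ w' := by
    intro t ht
    have hsub : Icc t₀ t ⊆ Icc t₀ t₁ := Icc_subset_Icc_right (ht.2.le.trans hτ.2)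
    have hne : ∀ x ∈ Icc t₀ t, s x ≠ ξ := fun x hx h =>
      absurd (hmin ⟨hsub hx, h⟩) (not_le.2 (hx.2.trans_lt ht.2))
    obtain ⟨w', hw', g, hg, hg0, hg1⟩ := H.exists_continuation hξ ht.1
      (fun x hx => ⟨hne x hx, hs x (hsub hx)⟩) hw
    have hu := (hf.mono hsub).unique hg isPreconnected_Icc (left_mem_Icc.2 ht.1)
      (right_mem_Icc.2 ht.1) (by rw [hg0]; exact hfw)
    have hw'0 : w' ≠ 0 := by
      rintro rfl
      exact hne t (right_mem_Icc.2 ht.1) (sub_eq_zero.1 (hw'.symm.trans (by simp)))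
    refine ⟨w', hw'0, hw', ?_⟩
    rw [hu.eq_of_nhds, hg1]
    simp only
    rw [← hw', sqrtBranch_self hw'0]
  obtain ⟨η, hη, hbig⟩ := H.exists_norm_leafValue_gt hξ (‖f τ (s τ)‖ + 1)
  have h1 : ∀ᶠ t in 𝓝[Icc t₀ t₁] τ, ‖f t (s t)‖ < ‖f τ (s τ)‖ + 1 :=
    (hf.continuousOn_value τ hτ).norm.eventually_lt_const (lt_add_one _)
  have h2 : ∀ᶠ t in 𝓝 τ, ‖s t - ξ‖ < η ^ 2 := by
    have : ContinuousAt (fun t => ‖s t - ξ‖) τ := by fun_prop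
    refine this.eventually_lt_const ?_
    simp only [hsτ', sub_self, norm_zero]
    positivity
  have hnb : (𝓝[Ico t₀ τ] τ).NeBot := by
    rw [← mem_closure_iff_nhdsWithin_neBot, closure_Ico hlt.ne]
    exact right_mem_Icc.2 hlt.le
  obtain ⟨t, ht1, ht2, ht3⟩ := ((h1.filter_mono (nhdsWithin_mono τ
    (Ico_subset_Icc_self.trans (Icc_subset_Icc_right hτ.2)))).and
    ((h2.filter_mono nhdsWithin_le_nhds).and self_mem_nhdsWithin)).exists (f := 𝓝[Ico t₀ τ] τ)
  obtain ⟨w', hw'0, hw', hv⟩ := hval t ht3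
  have h3 := hbig w' hw'0 (lt_of_pow_lt_pow_left₀ 2 hη.le (by rw [← norm_pow, hw']; exact ht2))
  rw [← hv] at h3
  exact lt_asymm h3 ht1

end Path

end IsLeafChart

/-! ### The leaf through a point, and its singular point -/

/-- Near `(0, b)`, the uniformizing parameter of the leaf through a point is an analytic function
of the point, and a local coordinate on the transversals `x = const`. -/
theorem IsLeafChart.exists_leaf_coordinate {p q : Polynomial ℂ} {b : ℂ} {m : ℂ × ℂ → ℂ} {δ : ℝ}
    (H : IsLeafChart p q b m δ) :
    ∃ W : ℂ × ℂ → ℂ, W (0, b) = 0 ∧ ∀ᶠ v in 𝓝 ((0 : ℂ), b), AnalyticAt ℂ W v ∧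
      W v * m (W v, v.2 - W v ^ 2) = v.1 ∧ deriv (fun v' => W (v', v.2)) v.1 ≠ 0 := by
  have h0 : (0 : ℂ) ∈ Metric.ball (0 : ℂ) δ := Metric.mem_ball_self H.pos
  have hb : b ∈ Metric.ball b δ := Metric.mem_ball_self H.pos
  have hm := H.analyticAt 0 h0 b hb
  have hx : AnalyticAt ℂ (fun x : (ℂ × ℂ) × ℂ => x.2) ((0, b), 0) := analyticAt_snd
  have hx1 : AnalyticAt ℂ (fun x : (ℂ × ℂ) × ℂ => x.1.1) ((0, b), 0) :=
    analyticAt_fst.comp analyticAt_fst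
  have hx2 : AnalyticAt ℂ (fun x : (ℂ × ℂ) × ℂ => x.1.2) ((0, b), 0) :=
    analyticAt_snd.comp analyticAt_fst
  have hcomp : AnalyticAt ℂ (fun x : (ℂ × ℂ) × ℂ => m (x.2, x.1.2 - x.2 ^ 2)) ((0, b), 0) := by
    refine AnalyticAt.comp (g := m) (f := fun x : (ℂ × ℂ) × ℂ => (x.2, x.1.2 - x.2 ^ 2)) ?_
      (hx.prod (hx2.sub (hx.pow 2)))
    simpa using hm
  -- A point `(v, x)` lies on the leaf with `ξ = x - w²`, so `w` solves `w m(w, x - w²) = v`; at `w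
  -- = 0` the derivative in `w` is `m(0, b) ≠ 0`.
  obtain ⟨W, hW, hW0, hWeq, -⟩ := exists_analytic_implicit (P := ℂ × ℂ) (E := ℂ)
    (Φ := fun x => x.2 * m (x.2, x.1.2 - x.2 ^ 2) - x.1.1) (π₀ := (0, b)) (z₀ := 0)
    (by
      have : AnalyticAt ℂ (fun x : (ℂ × ℂ) × ℂ => x.2 * m (x.2, x.1.2 - x.2 ^ 2) - x.1.1)
        ((0, b), 0) := (hx.mul hcomp).sub hx1
      exact this.contDiffAt) (by simp) H.base_ne_zero (by
      have h1 : AnalyticAt ℂ (fun z : ℂ => m (z, b - z ^ 2)) 0 := by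
        refine AnalyticAt.comp (g := m) (f := fun z : ℂ => (z, b - z ^ 2)) ?_ (by fun_prop)
        simpa using hm
      have h2 := ((hasDerivAt_id (0 : ℂ)).mul h1.differentiableAt.hasDerivAt).sub_const 0
      refine h2.hasFDerivAt.congr_fderiv ?_
      ext
      simp)
  refine ⟨W, hW0, ?_⟩
  have hmW : AnalyticAt ℂ m (W (0, b), (0, b).2 - W (0, b) ^ 2) := by simpa [hW0] using hm
  have hc : ContinuousAt (fun v : ℂ × ℂ => (W v, v.2 - W v ^ 2)) (0, b) := by
    have := hW.continuousAt
    fun_prop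
  filter_upwards [hW.eventually_analyticAt, hWeq, hWeq.eventually_nhds,
    hc.eventually hmW.eventually_analyticAt] with v h1 h2 h3 h4
  obtain ⟨v, x⟩ := v
  refine ⟨h1, sub_eq_zero.1 h2, fun hd => ?_⟩
  have h5 : AnalyticAt ℂ (fun v' => W (v', x)) v :=
    AnalyticAt.comp (g := W) (f := fun v' => (v', x)) h1 (by fun_prop)
  have h6 : AnalyticAt ℂ (fun w => w * m (w, x - w ^ 2)) (W (v, x)) :=
    analyticAt_id.mul (AnalyticAt.comp (g := m) (f := fun w => (w, x - w ^ 2)) h4 (by fun_prop))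
  have h7 := h6.differentiableAt.hasDerivAt.comp v h5.differentiableAt.hasDerivAt
  rw [hd, mul_zero] at h7
  have hcv : ContinuousAt (fun v' : ℂ => (v', x)) v := by fun_prop
  have h8 : ((fun w => w * m (w, x - w ^ 2)) ∘ fun v' => W (v', x)) =ᶠ[𝓝 v] id := by
    filter_upwards [hcv.eventually h3] with v' hv'
    exact sub_eq_zero.1 hv'
  exact zero_ne_one ((h7.congr_of_eventuallyEq h8.symm).unique (hasDerivAt_id v))

/-- The solution with value `y` at the start of `s`, continued up to `s c`, lies on the leaf with
singular point `ξ`. -/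
def IsOnLeaf (p q : Polynomial ℂ) {a b : ℂ} (s : Path a b) (c : I) (m : ℂ × ℂ → ℂ) (y ξ : ℂ) :
    Prop :=
  ∃ (F : I → ℂ → ℂ) (w : ℂ), SolutionContinues p q s (Iic c) y F ∧ w ≠ 0 ∧ w ^ 2 = s c - ξ ∧
    F c =ᶠ[𝓝 (s c)] fun z => leafValue m ξ (sqrtBranch w (z - ξ))

section Leaf

variable {p q : Polynomial ℂ} {a b : ℂ} {s : Path a b} {c : I} {m : ℂ × ℂ → ℂ} {δ r : ℝ} {y ξ : ℂ}

theorem norm_sub_lt_of_mem_ball {z : ℂ} (hr : 2 * r ≤ δ ^ 2)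
    (hz : z ∈ Metric.ball b r) (hξ : ξ ∈ Metric.ball b r) : ‖z - ξ‖ < δ ^ 2 := by
  rw [← dist_eq_norm]
  refine (dist_triangle_right _ _ b).trans_lt ?_
  have h1 := Metric.mem_ball.1 hz
  have h2 := Metric.mem_ball.1 hξ
  linarith

/-- A solution on a leaf continues along the path until the path meets the singular point. -/
theorem IsOnLeaf.solutionContinues (h : IsOnLeaf p q s c m y ξ) (H : IsLeafChart p q b m δ)
    (hrδ : r ≤ δ) (hr : 2 * r ≤ δ ^ 2) (hξ : ξ ∈ Metric.ball b r) {d : I} (hcd : c ≤ d)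
    (hs : ∀ t ∈ Icc c d, s t ∈ Metric.ball b r) (hne : ∀ t ∈ Icc c d, s t ≠ ξ) :
    ∃ F, SolutionContinues p q s (Iic d) y F ∧
      ∃ w, w ^ 2 = s d - ξ ∧ F d (s d) = leafValue m ξ w := by
  obtain ⟨F, w, hF, hw0, hw, hFw⟩ := h
  obtain ⟨w', hw', g, hg, hg0, hg1⟩ := H.exists_continuation (Metric.ball_subset_ball hrδ hξ) hcd
    (fun t ht => ⟨hne t ht, norm_sub_lt_of_mem_ball hr (hs t ht) hξ⟩) hw
  obtain ⟨G, hG, hG1⟩ := hF.glue hcd hg (by rw [hg0]; exact hFw)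
  refine ⟨G, hG, w', hw', ?_⟩
  have hw'0 : w' ≠ 0 := by
    rintro rfl
    exact hne d ⟨hcd, le_rfl⟩ (sub_eq_zero.1 (hw'.symm.trans (by simp)))
  rw [hG1.eq_of_nhds, hg1]
  simp only
  rw [← hw', sqrtBranch_self hw'0]

/-- If a solution on a leaf continues along the path, then the path avoids the singular point. -/
theorem IsOnLeaf.ne_of_solutionContinues (h : IsOnLeaf p q s c m y ξ) (H : IsLeafChart p q b m δ)
    (hrδ : r ≤ δ) (hr : 2 * r ≤ δ ^ 2) (hξ : ξ ∈ Metric.ball b r) {d : I} (hcd : c ≤ d)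
    (hs : ∀ t ∈ Icc c d, s t ∈ Metric.ball b r) {G : I → ℂ → ℂ}
    (hG : SolutionContinues p q s (Iic d) y G) : ∀ t ∈ Icc c d, s t ≠ ξ := by
  obtain ⟨F, w, hF, hw0, hw, hFw⟩ := h
  refine H.ne_of_continuation (Metric.ball_subset_ball hrδ hξ) (hG.2.mono fun t ht => ht.2)
    (fun t ht => norm_sub_lt_of_mem_ball hr (hs t ht) hξ) hw hw0 (EventuallyEq.trans ?_ hFw)
  exact (hG.mono (Iic_subset_Iic.2 hcd)).unique hF isPreconnected_Iic
    (zero_mem_Iic_unitInterval c) self_mem_Iic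

/-- In the parameter `√(z - ξ)` the solution is analytic except for a pole at `0`; the root can be
followed along any path avoiding `ξ`. -/
theorem IsOnLeaf.isOnlySingularity (h : IsOnLeaf p q s c m y ξ) (H : IsLeafChart p q b m δ)
    (hrδ : r ≤ δ) (hr : 2 * r ≤ δ ^ 2) (hξ : ξ ∈ Metric.ball b r)
    (hs : s c ∈ Metric.ball b r) : IsOnlySingularity p q s c (Metric.ball b r) y ξ := by
  obtain ⟨F, w, hF, hw0, hw, hFw⟩ := h
  have hξ' := Metric.ball_subset_ball hrδ hξ
  refine ⟨hξ, hs, fun h => ?_, F, hF, ?_, ?_⟩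
  · rw [h, sub_self] at hw
    exact hw0 (pow_eq_zero_iff two_ne_zero |>.1 hw)
  · intro d τ hτ
    obtain ⟨-, -, g, hg, hg0, -⟩ := H.exists_continuation (s := τ) (t₀ := 0) (t₁ := 1) hξ'
      zero_le_one (fun t _ => ⟨(hτ t).2, norm_sub_lt_of_mem_ball hr (hτ t).1 hξ⟩)
      (by rw [τ.source]; exact hw)
    refine ⟨g, hg.mono fun t _ => ⟨t.2.1, t.2.2⟩, ?_⟩
    rw [hg0]
    exact hFw.symm
  · rintro τ hτ - ⟨g, hg, hg0⟩
    refine H.ne_of_continuation (s := τ) (t₀ := 0) (t₁ := 1) hξ' (hg.mono (subset_univ _))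
      (fun t _ => norm_sub_lt_of_mem_ball hr (hτ t) hξ) (by rw [τ.source]; exact hw) hw0 ?_ 1
      ⟨zero_le_one, le_rfl⟩ τ.target
    rw [τ.source]
    exact hg0.trans hFw

end Leaf

/-! ### Germs of the Poincaré mapping -/

theorem Iic_one_unitInterval : Iic (1 : I) = univ := eq_univ_of_forall fun t => t.2.2

section Poincare

variable {p q : Polynomial ℂ} {a b : ℂ} {s : Path a b} {y : ℂ}

theorem SolutionContinues.exists_poincareGerm {f : I → ℂ → ℂ}
    (hf : SolutionContinues p q s univ y f) :
    ∃ φ : ℂ → ℂ, IsPoincareGerm p q s y φ ∧ AnalyticAt ℂ φ y := by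
  rw [← Iic_one_unitInterval] at hf
  obtain ⟨Y, hY, -, -, h⟩ := hf.exists_analytic_dependence
  refine ⟨Y, h.mono ?_, hY⟩
  rintro y' ⟨F, hF, hFY⟩
  rw [Iic_one_unitInterval] at hF
  exact ⟨F, hF, by rw [← hFY, s.target]⟩

theorem IsPoincareGerm.unique {φ ψ : ℂ → ℂ} (hφ : IsPoincareGerm p q s y φ)
    (hψ : IsPoincareGerm p q s y ψ) : φ =ᶠ[𝓝 y] ψ := by
  filter_upwards [hφ, hψ] with y' h1 h2
  obtain ⟨f, hf, hfv⟩ := h1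
  obtain ⟨g, hg, hgv⟩ := h2
  have h3 := (hf.unique hg isPreconnected_univ (mem_univ 0) (mem_univ 1)).eq_of_nhds
  rw [s.target] at h3
  rw [← hfv, ← hgv, h3]

/-- Continuation of the single solution with value `y` already produces an analytic representative,
and representatives agree near `y`. -/
theorem IsPoincareGerm.analyticAt {φ : ℂ → ℂ} (hφ : IsPoincareGerm p q s y φ) :
    AnalyticAt ℂ φ y := by
  obtain ⟨f, hf, -⟩ := hφ.self_of_nhds
  obtain ⟨ψ, hψ, hψa⟩ := hf.exists_poincareGerm
  exact hψa.congr (hψ.unique hφ)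

end Poincare

/-! ### The position of the singularity and the curve `γ` -/

/-- The position of the singularity near `b` is an injective analytic function of the initial
value. -/
theorem exists_singularity_position {p q : Polynomial ℂ} {a b y₀ : ℂ} {s : Path a b}
    {m : ℂ × ℂ → ℂ} {δ : ℝ} (H : IsLeafChart p q b m δ) {f : I → ℂ → ℂ}
    (hf : SolutionContinues p q s (Iio 1) y₀ f)
    (hsing : ¬ ∃ f : I → ℂ → ℂ, SolutionContinues p q s univ y₀ f) :
    ∃ (V : Set ℂ) (c : I) (r : ℝ) (x₀ : ℂ → ℂ), IsOpen V ∧ y₀ ∈ V ∧ c < 1 ∧ 0 < r ∧ r ≤ δ ∧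
      2 * r ≤ δ ^ 2 ∧ (∀ t, c ≤ t → s t ∈ Metric.ball b r) ∧
      (∀ y ∈ V, x₀ y ∈ Metric.ball b r ∧ IsOnLeaf p q s c m y (x₀ y)) ∧ x₀ y₀ = b ∧
      AnalyticOnNhd ℂ x₀ V ∧ InjOn x₀ V ∧ (∀ y ∈ V, deriv x₀ y ≠ 0) ∧
      ∀ t, c ≤ t → t < 1 → s t ≠ b := by
  obtain ⟨W, hW0, hW⟩ := H.exists_leaf_coordinate
  -- With `2 r ≤ δ²`, square roots of differences of two points of the `r`-disk lie in the `δ`-disk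
  -- of the chart.
  obtain ⟨r, hr0, hrδ, hr⟩ : ∃ r : ℝ, 0 < r ∧ r ≤ δ ∧ 2 * r ≤ δ ^ 2 := by
    have := H.pos
    refine ⟨min δ (δ ^ 2 / 2), by positivity, min_le_left _ _, ?_⟩
    have := min_le_right δ (δ ^ 2 / 2)
    linarith
  have hWb : ∀ᶠ v in 𝓝 ((0 : ℂ), b), v.2 - W v ^ 2 ∈ Metric.ball b r := by
    have hc : ContinuousAt (fun v : ℂ × ℂ => v.2 - W v ^ 2) (0, b) := by
      have := hW.self_of_nhds.1.continuousAt
      fun_prop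
    refine hc.eventually (Metric.isOpen_ball.mem_nhds ?_)
    simpa [hW0] using hr0
  have hgood := (hW.and hWb).eventually_nhds
  have hinf := hf.tendsto_norm_atTop hsing
  have hs1 : Tendsto s (𝓝[<] 1) (𝓝 b) := by
    have := s.continuous.continuousAt (x := (1 : I))
    rw [ContinuousAt, s.target] at this
    exact this.mono_left nhdsWithin_le_nhds
  have hv : Tendsto (fun t => ((f t (s t))⁻¹, s t)) (𝓝[<] 1) (𝓝 ((0 : ℂ), b)) := by
    refine Tendsto.prodMk_nhds ?_ hs1
    exact Filter.tendsto_inv₀_cobounded.comp (tendsto_norm_atTop_iff_cobounded.1 hinf)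
  have hsb : ∀ᶠ t in 𝓝[<] (1 : I), ∀ t', t ≤ t' → s t' ∈ Metric.ball b r := by
    have h1 : ∀ᶠ t in 𝓝 (1 : I), s t ∈ Metric.ball b r := by
      refine s.continuous.continuousAt.eventually (Metric.isOpen_ball.mem_nhds ?_)
      simpa using hr0
    obtain ⟨e, he, h2⟩ := Metric.eventually_nhds_iff.1 h1
    filter_upwards [nhdsWithin_le_nhds (Metric.ball_mem_nhds (1 : I) he)] with t ht t' htt'
    refine h2 ?_
    rw [Metric.mem_ball, Subtype.dist_eq, Real.dist_eq, abs_lt] at ht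
    rw [Subtype.dist_eq, Real.dist_eq, abs_lt]
    have h3 : (t : ℝ) ≤ t' := htt'
    have h4 : (t' : ℝ) ≤ 1 := t'.2.2
    simp only [Icc.coe_one] at ht ⊢
    exact ⟨by linarith, by linarith⟩
  have hnb : (𝓝[<] (1 : I)).NeBot := nhdsLT_neBot_of_exists_lt ⟨0, zero_lt_one⟩
  -- The time `c` is so late that `(1/f, s)` is in the domain of the leaf coordinate, `f` is
  -- nonzero, and the rest of the path stays in the disk.
  obtain ⟨c, hc, hfc, hsc, hc1⟩ := ((hv.eventually hgood).and
    ((hinf.eventually_gt_atTop 0).and (hsb.and self_mem_nhdsWithin))).exists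
  have hc1 : c < 1 := hc1
  have hfc0 : f c (s c) ≠ 0 := norm_pos_iff.1 hfc
  obtain ⟨Y, hY, hY', hY0, hYF⟩ := (hf.mono (Iic_subset_Iio.2 hc1)).exists_analytic_dependence
  have hYne : Y y₀ ≠ 0 := by rwa [hY0]
  set v : ℂ → ℂ × ℂ := fun y => ((Y y)⁻¹, s c) with hvdef
  have hva : AnalyticAt ℂ v y₀ := (hY.inv hYne).prod analyticAt_const
  have hv0 : v y₀ = ((f c (s c))⁻¹, s c) := by rw [hvdef, ← hY0]
  rw [← hv0] at hc
  set x₀ : ℂ → ℂ := fun y => s c - W (v y) ^ 2 with hx₀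
  have hWa : AnalyticAt ℂ W (v y₀) := hc.self_of_nhds.1.1
  have hWv : AnalyticAt ℂ (fun y => W (v y)) y₀ := hWa.comp hva
  have hxa : AnalyticAt ℂ x₀ y₀ := analyticAt_const.sub (hWv.pow 2)
  have hWne : ∀ y, W (v y) * m (W (v y), s c - W (v y) ^ 2) = (Y y)⁻¹ → Y y ≠ 0 → W (v y) ≠ 0 := by
    intro y h1 h2 h3
    rw [h3, zero_mul] at h1
    exact inv_ne_zero h2 h1.symm
  -- By the chain rule the derivative is `-2 W · ∂W/∂v · (-Y'/Y²)`, with all factors nonzero.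
  have hxd : deriv x₀ y₀ ≠ 0 := by
    have h1 : AnalyticAt ℂ (fun u => W (u, s c)) (Y y₀)⁻¹ :=
      AnalyticAt.comp (g := W) (f := fun u => (u, s c)) hWa (by fun_prop)
    have h2 := h1.differentiableAt.hasDerivAt.comp y₀ (hY.differentiableAt.hasDerivAt.inv hYne)
    have h3 : HasDerivAt x₀ _ y₀ := (h2.pow 2).const_sub (s c)
    rw [h3.deriv]
    have h4 := hWne y₀ hc.self_of_nhds.1.2.1 hYne
    have h5 := hc.self_of_nhds.1.2.2
    simp only [Nat.cast_ofNat, Nat.add_one_sub_one, pow_one, Function.comp_apply]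
    refine neg_ne_zero.2 (mul_ne_zero (mul_ne_zero two_ne_zero h4) (mul_ne_zero h5 ?_))
    exact div_ne_zero (neg_ne_zero.2 hY') (pow_ne_zero 2 hYne)
  have hloc : ∀ᶠ y in 𝓝 y₀, x₀ y ∈ Metric.ball b r ∧ IsOnLeaf p q s c m y (x₀ y) := by
    filter_upwards [hva.continuousAt.eventually hc, hY.continuousAt.eventually_ne hYne, hYF]
      with y h1 h2 h3
    obtain ⟨⟨h4, h5, -⟩, h6⟩ := h1
    obtain ⟨F, hF, hFY⟩ := h3
    have hw0 := hWne y h5 h2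
    have hξ' := Metric.ball_subset_ball hrδ h6
    have hwx : W (v y) ^ 2 = s c - x₀ y := by rw [hx₀]; ring
    refine ⟨h6, F, W (v y), hF, hw0, hwx, ?_⟩
    refine SolvesAbelNear.unique (p := p) (q := q) (hF.solvesAbelNear isPreconnected_Iic
      (zero_mem_Iic_unitInterval c) self_mem_Iic) (H.solvesAbelNear (H.mem_ball_of_sq_eq hwx
        (norm_sub_lt_of_mem_ball hr (hsc c le_rfl) h6)) hw0 hξ' hwx) ?_
    rw [hFY, ← hwx, sqrtBranch_self hw0, leafValue]
    exact (inv_eq_iff_eq_inv.2 h5).symm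
  have hstrict := hxa.hasStrictDerivAt.hasStrictFDerivAt_equiv hxd
  set e := hstrict.toOpenPartialHomeomorph x₀ with he
  have hey : y₀ ∈ e.source := hstrict.mem_toOpenPartialHomeomorph_source
  obtain ⟨V, hV, hVo, hyV⟩ := eventually_nhds_iff.1 ((hloc.and (hxa.eventually_analyticAt.and
    (hxa.deriv.continuousAt.eventually_ne hxd))).and (e.open_source.eventually_mem hey))
  have hy₀ := (hV y₀ hyV).1.1
  have hne : ∀ t, c ≤ t → t < 1 → s t ≠ x₀ y₀ := fun t ht ht1 =>
    hy₀.2.ne_of_solutionContinues H hrδ hr hy₀.1 ht (fun t' ht' => hsc t' ht'.1)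
      (hf.mono (Iic_subset_Iio.2 ht1)) t ⟨ht, le_rfl⟩
  -- The path does not meet `x₀ y₀` before its end; were `b` also different from it, the solution
  -- would continue along the whole path.
  have hxb : x₀ y₀ = b := by
    by_contra hcon
    obtain ⟨F, hF, -⟩ := hy₀.2.solutionContinues H hrδ hr hy₀.1 hc1.le
      (fun t' ht' => hsc t' ht'.1) (fun t ht => by
        rcases ht.2.lt_or_eq with h1 | rfl
        · exact hne t ht.1 h1
        · rw [s.target]; exact Ne.symm hcon)
    rw [Iic_one_unitInterval] at hF
    exact hsing ⟨F, hF⟩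
  refine ⟨V, c, r, x₀, hVo, hyV, hc1, hr0, hrδ, hr, hsc, fun y hy => (hV y hy).1.1, hxb,
    fun y hy => (hV y hy).1.2.1, ?_, fun y hy => (hV y hy).1.2.2, ?_⟩
  · intro y hy y' hy' h
    exact e.injOn (hV y hy).2 (hV y' hy').2 h
  · exact fun t ht ht1 h => hne t ht ht1 (h.trans hxb.symm)

/-- The preimage of the end part of a path under an injective analytic function is a curve, as
regular as the path. -/
theorem exists_preimage_curve {a b y₀ : ℂ} {s : Path a b} {V : Set ℂ} {c : I} {x₀ : ℂ → ℂ}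
    (hV : IsOpen V) (hy₀ : y₀ ∈ V) (hc : c < 1) (hx₀ : x₀ y₀ = b) (ha : AnalyticOnNhd ℂ x₀ V)
    (hinj : InjOn x₀ V) (hd : ∀ y ∈ V, deriv x₀ y ≠ 0) (hne : ∀ t, c ≤ t → t < 1 → s t ≠ b) :
    ∃ (c' : I) (κ : ℝ → ℂ), c ≤ c' ∧ c' < 1 ∧ κ 1 = y₀ ∧
        ContinuousOn κ (Icc (c' : ℝ) 1) ∧
        (∀ t ∈ Icc (c' : ℝ) 1, κ t ∈ V ∧ x₀ (κ t) = s.extend t) ∧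
        (∀ (n : ℕ∞) (J : Set ℝ), J ⊆ Icc (c' : ℝ) 1 →
          ContDiffOn ℝ n s.extend J → ContDiffOn ℝ n κ J) ∧
        ∀ᶠ y in 𝓝 y₀, y ∈ {y ∈ V | ∃ t, c ≤ t ∧ x₀ y = s t} ↔ y ∈ κ '' Icc (c' : ℝ) 1 := by
  have hstrict := (ha y₀ hy₀).hasStrictDerivAt.hasStrictFDerivAt_equiv (hd y₀ hy₀)
  set e := hstrict.toOpenPartialHomeomorph x₀ with he
  have hex : ∀ y, e y = x₀ y := fun y => rfl
  have hey : y₀ ∈ e.source := hstrict.mem_toOpenPartialHomeomorph_source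
  have hebt : b ∈ e.target := by rw [← hx₀]; exact e.map_source hey
  have heb : e.symm b = y₀ := by rw [← hx₀]; exact e.left_inv hey
  have hN : ∀ᶠ z in 𝓝 b, z ∈ e.target ∧ e.symm z ∈ V :=
    (e.open_target.eventually_mem hebt).and
      ((e.continuousAt_symm hebt).eventually (hV.mem_nhds (by rwa [heb])))
  have hc' : ∃ c' : I, c ≤ c' ∧ c' < 1 ∧ ∀ t, c' ≤ t → s t ∈ e.target ∧ e.symm (s t) ∈ V := by
    have h1 : ∀ᶠ t in 𝓝 (1 : I), s t ∈ e.target ∧ e.symm (s t) ∈ V := by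
      have := s.continuous.continuousAt (x := (1 : I))
      rw [ContinuousAt, s.target] at this
      exact this.eventually hN
    obtain ⟨l, hl, h2⟩ := exists_Ioc_subset_of_mem_nhds h1 ⟨c, hc⟩
    obtain ⟨c', hc'1, hc'2⟩ := exists_between (max_lt hc hl)
    exact ⟨c', ((le_max_left _ _).trans_lt hc'1).le, hc'2, fun t ht =>
      h2 ⟨((le_max_right _ _).trans_lt hc'1).trans_le ht, t.2.2⟩⟩
  obtain ⟨c', hcc', hc'1, hc'⟩ := hc'
  have hext : ∀ t ∈ Icc (c' : ℝ) 1, ∃ t' : I, c' ≤ t' ∧ (t' : ℝ) = t ∧ s.extend t = s t' := by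
    intro t ht
    have htI : t ∈ I := ⟨c'.2.1.trans ht.1, ht.2⟩
    exact ⟨⟨t, htI⟩, ht.1, rfl, s.extend_apply htI⟩
  have hmem : ∀ t ∈ Icc (c' : ℝ) 1, s.extend t ∈ e.target ∧ e.symm (s.extend t) ∈ V := by
    intro t ht
    obtain ⟨t', ht', -, h⟩ := hext t ht
    rw [h]
    exact hc' t' ht'
  refine ⟨c', fun t => e.symm (s.extend t), hcc', hc'1, ?_, ?_, ?_, ?_, ?_⟩
  · simp only [s.extend_one, heb]
  · exact e.continuousOn_symm.comp s.continuous_extend.continuousOn fun t ht => (hmem t ht).1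
  · exact fun t ht => ⟨(hmem t ht).2, e.right_inv (hmem t ht).1⟩
  · intro n J hJ hsJ t ht
    obtain ⟨h1, h2⟩ := hmem t (hJ ht)
    have h3 : ContDiffAt ℂ n e.symm (s.extend t) :=
      e.contDiffAt_symm_deriv (f₀' := deriv x₀ (e.symm (s.extend t))) (hd _ h2) h1
        (ha _ h2).differentiableAt.hasDerivAt (ha _ h2).contDiffAt
    exact (h3.restrict_scalars ℝ).comp_contDiffWithinAt t (hsJ t ht)
  -- The compact arc `s([c, c'])` misses `b`, so for `y` near `y₀` only parameters beyond `c'`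
  -- contribute to `γ`.
  · have hK : IsCompact (s '' Icc c c') := isCompact_Icc.image s.continuous
    have hbK : b ∉ s '' Icc c c' := by
      rintro ⟨t, ht, h⟩
      exact hne t ht.1 (ht.2.trans_lt hc'1) h
    have h1 : ∀ᶠ y in 𝓝 y₀, x₀ y ∉ s '' Icc c c' :=
      (ha y₀ hy₀).continuousAt.eventually (hK.isClosed.isOpen_compl.mem_nhds (by rwa [hx₀]))
    filter_upwards [h1, hV.mem_nhds hy₀] with y hy hyV
    constructor
    · rintro ⟨-, t, ht, hyt⟩
      have hct : c' ≤ t := by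
        by_contra hcon
        exact hy ⟨t, ⟨ht, (not_le.1 hcon).le⟩, hyt.symm⟩
      refine ⟨t, ⟨hct, t.2.2⟩, ?_⟩
      have h2 := hc' t hct
      have h3 : s.extend (t : ℝ) = s t := s.extend_apply t.2
      simp only [h3]
      refine hinj h2.2 hyV ?_
      rw [← hex, e.right_inv h2.1, hyt]
    · rintro ⟨t, ht, rfl⟩
      obtain ⟨t', ht', -, h⟩ := hext t ht
      refine ⟨hyV, t', hcc'.trans ht', ?_⟩
      rw [← h]
      exact e.right_inv (hmem t ht).1

/-! ### The Puiseux series -/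

/-- The values at `b` of the solutions on the leaves are given by a Puiseux series in `y - y₀`. -/
theorem IsLeafChart.exists_puiseux {p q : Polynomial ℂ} {b : ℂ} {m : ℂ × ℂ → ℂ} {δ r : ℝ}
    (H : IsLeafChart p q b m δ) (hr : 2 * r ≤ δ ^ 2) {y₀ : ℂ} {V : Set ℂ}
    {x₀ : ℂ → ℂ} (hV : IsOpen V) (hy₀ : y₀ ∈ V) (hx₀ : x₀ y₀ = b) (ha : AnalyticOnNhd ℂ x₀ V)
    (hd : deriv x₀ y₀ ≠ 0) (hVr : ∀ y ∈ V, x₀ y ∈ Metric.ball b r) :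
    ∃ (ρ : ℝ) (ν : ℕ → ℂ), 0 < ρ ∧ Metric.ball y₀ ρ ⊆ V ∧ ν 0 ≠ 0 ∧
      (∀ w : ℂ, ‖w‖ ^ 2 < ρ → Summable fun k : ℕ => ν k * w ^ k) ∧
      (∀ w : ℂ, w ≠ 0 → ‖w‖ ^ 2 < ρ → AnalyticAt ℂ (puiseuxSum ν) w) ∧
      ∀ w : ℂ, w ≠ 0 → ‖w‖ ^ 2 < ρ → ∃ w', w' ≠ 0 ∧ w' ∈ Metric.ball (0 : ℂ) δ ∧
        w' ^ 2 = b - x₀ (y₀ + w ^ 2) ∧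
        puiseuxSum ν w = leafValue m (x₀ (y₀ + w ^ 2)) w' ∧
        puiseuxSum ν (-w) = leafValue m (x₀ (y₀ + w ^ 2)) (-w') := by
  have hr0 : 0 < r := Metric.nonempty_ball.1 ⟨_, hVr y₀ hy₀⟩
  have hδ0 : (0 : ℂ) ∈ Metric.ball (0 : ℂ) δ := Metric.mem_ball_self H.pos
  have hbδ : b ∈ Metric.ball b δ := Metric.mem_ball_self H.pos
  -- Factor `b - x₀ y = (y - y₀) g y` with `g y₀ = -x₀'(y₀) ≠ 0`; with `h = √g` and `y = y₀ + w²`,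
  -- the leaf parameter at `b` is `w h(y)`.
  set g : ℂ → ℂ := fun y => -dslope x₀ y₀ y with hg
  have hga : AnalyticAt ℂ g y₀ := by
    obtain ⟨P, hP⟩ := ha y₀ hy₀
    exact (HasFPowerSeriesAt.has_fpower_series_dslope_fslope hP).analyticAt.neg
  have hg0 : g y₀ ≠ 0 := by
    simp only [hg, dslope_same]
    exact neg_ne_zero.2 hd
  have hgx : ∀ y, b - x₀ y = (y - y₀) * g y := fun y => by
    have := sub_smul_dslope x₀ y₀ y
    rw [hx₀, smul_eq_mul] at this
    rw [hg]
    linear_combination this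
  obtain ⟨w₀, hw₀⟩ := IsAlgClosed.exists_pow_nat_eq (g y₀) (n := 2) (by norm_num)
  have hw₀0 : w₀ ≠ 0 := by
    rintro rfl
    exact hg0 (by rw [← hw₀]; simp)
  set h : ℂ → ℂ := fun y => sqrtBranch w₀ (g y) with hh
  have hha : AnalyticAt ℂ h y₀ := by
    refine AnalyticAt.comp (g := sqrtBranch w₀) ?_ hga
    rw [← hw₀]
    exact analyticAt_sqrtBranch hw₀0
  have hhsq : ∀ y, h y ^ 2 = g y := fun y => sqrtBranch_sq hw₀0 _
  have hh0 : h y₀ ≠ 0 := fun h0 => hg0 (by rw [← hhsq, h0]; simp)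
  have hu : AnalyticAt ℂ (fun w : ℂ => y₀ + w ^ 2) 0 := by fun_prop
  have hhu : AnalyticAt ℂ (fun w : ℂ => h (y₀ + w ^ 2)) 0 :=
    AnalyticAt.comp (g := h) (by simpa using hha) hu
  have hxu : AnalyticAt ℂ (fun w : ℂ => x₀ (y₀ + w ^ 2)) 0 :=
    AnalyticAt.comp (g := x₀) (by simpa using ha y₀ hy₀) hu
  set N : ℂ → ℂ := fun w => h (y₀ + w ^ 2) * m (w * h (y₀ + w ^ 2), x₀ (y₀ + w ^ 2)) with hN
  have hNa : AnalyticAt ℂ N 0 := by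
    refine hhu.mul (AnalyticAt.comp (g := m)
      (f := fun w : ℂ => (w * h (y₀ + w ^ 2), x₀ (y₀ + w ^ 2))) ?_ ((analyticAt_id.mul hhu).prod hxu))
    simpa [hx₀] using H.analyticAt 0 hδ0 b hbδ
  have hN0 : N 0 ≠ 0 := by
    simp only [hN, zero_mul, ne_eq, OfNat.ofNat_ne_zero, not_false_eq_true, zero_pow, add_zero, hx₀]
    exact mul_ne_zero hh0 H.base_ne_zero
  have hev : ∀ᶠ w in 𝓝 (0 : ℂ), y₀ + w ^ 2 ∈ V ∧ AnalyticAt ℂ (fun w => (N w)⁻¹) w ∧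
      h (y₀ + w ^ 2) ≠ 0 := by
    refine (hu.continuousAt.eventually (hV.mem_nhds (by simpa using hy₀))).and
      ((hNa.inv hN0).eventually_analyticAt.and (hhu.continuousAt.eventually_ne (by simpa using hh0)))
  obtain ⟨R, hR, hball⟩ := Metric.eventually_nhds_iff_ball.1 hev
  have hsq : ∀ w : ℂ, ‖w‖ ^ 2 < R ^ 2 → w ∈ Metric.ball (0 : ℂ) R := fun w hw => by
    rw [mem_ball_zero_iff]
    exact lt_of_pow_lt_pow_left₀ 2 hR.le hw
  -- The value at `b` is `w⁻¹ (N w)⁻¹`, so the coefficients are the Taylor coefficients of `1/N`.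
  set ν : ℕ → ℂ := fun k => (k.factorial : ℂ)⁻¹ * iteratedDeriv k (fun w => (N w)⁻¹) 0 with hν
  have hsum : ∀ w : ℂ, ‖w‖ ^ 2 < R ^ 2 → HasSum (fun k : ℕ => ν k * w ^ k) (N w)⁻¹ := by
    intro w hw
    have h1 := Complex.hasSum_taylorSeries_on_ball (f := fun w => (N w)⁻¹) (c := 0) (r := R)
      (fun w hw => (hball w hw).2.1.differentiableAt.differentiableWithinAt) (hsq w hw)
    refine h1.congr_fun fun k => ?_
    simp only [hν, sub_zero, smul_eq_mul]
    ring
  have hpu : ∀ w : ℂ, ‖w‖ ^ 2 < R ^ 2 → puiseuxSum ν w = w⁻¹ * (N w)⁻¹ := fun w hw => by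
    rw [puiseuxSum, (hsum w hw).tsum_eq]
  -- Under `y = y₀ + w²`, the disk `‖w‖ < R` covers `‖y - y₀‖ < R²`.
  refine ⟨R ^ 2, ν, by positivity, ?_, ?_, fun w hw => (hsum w hw).summable, ?_, ?_⟩
  · intro y hy
    obtain ⟨w, hw⟩ := IsAlgClosed.exists_pow_nat_eq (y - y₀) (n := 2) (by norm_num)
    rw [Metric.mem_ball, dist_eq_norm, ← hw, norm_pow] at hy
    have := (hball w (hsq w hy)).1
    rwa [hw, add_sub_cancel] at this
  · simpa [hν] using hN0
  · intro w hw0 hw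
    have h1 : AnalyticAt ℂ (fun w => w⁻¹ * (N w)⁻¹) w :=
      (analyticAt_id.inv hw0).mul (hball w (hsq w hw)).2.1
    refine h1.congr ?_
    filter_upwards [Metric.isOpen_ball.mem_nhds (hsq w hw)] with w' hw'
    refine (hpu w' ?_).symm
    rw [mem_ball_zero_iff] at hw'
    exact pow_lt_pow_left₀ hw' (norm_nonneg _) two_ne_zero
  · intro w hw0 hw
    obtain ⟨h1, -, h3⟩ := hball w (hsq w hw)
    have h4 : (w * h (y₀ + w ^ 2)) ^ 2 = b - x₀ (y₀ + w ^ 2) := by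
      rw [mul_pow, hhsq, hgx]
      ring
    refine ⟨w * h (y₀ + w ^ 2), mul_ne_zero hw0 h3, ?_, h4, ?_, ?_⟩
    · exact H.mem_ball_of_sq_eq h4
        (norm_sub_lt_of_mem_ball hr (Metric.mem_ball_self hr0) (hVr _ h1))
    · rw [hpu w hw, leafValue, hN, ← mul_inv, mul_assoc]
    · rw [hpu (-w) (by rwa [norm_neg]), leafValue, hN, ← mul_inv]
      simp only [neg_sq, neg_mul, mul_assoc]

/-! ### Double-valued functions on a punctured disk -/

theorem sqrtBranch_neg (w z : ℂ) : sqrtBranch (-w) z = -sqrtBranch w z := by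
  simp [sqrtBranch]

/-- An analytic germ whose values are among those of two analytic germs agrees with one of them. -/
theorem AnalyticAt.eventuallyEq_or_eventuallyEq {φ g h : ℂ → ℂ} {z : ℂ} (hφ : AnalyticAt ℂ φ z)
    (hg : AnalyticAt ℂ g z) (hh : AnalyticAt ℂ h z) (H : ∀ᶠ x in 𝓝 z, φ x = g x ∨ φ x = h x) :
    φ =ᶠ[𝓝 z] g ∨ φ =ᶠ[𝓝 z] h := by
  rcases (hφ.sub hg).eventually_eq_zero_or_eventually_ne_zero with h1 | h1
  · exact Or.inl (h1.mono fun x hx => sub_eq_zero.1 hx)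
  rcases (hφ.sub hh).eventually_eq_zero_or_eventually_ne_zero with h2 | h2
  · exact Or.inr (h2.mono fun x hx => sub_eq_zero.1 hx)
  obtain ⟨x, h3, h4, h5⟩ := (h1.and (h2.and (H.filter_mono nhdsWithin_le_nhds))).exists
  rcases h5 with h5 | h5
  · exact absurd (sub_eq_zero.2 h5) h3
  · exact absurd (sub_eq_zero.2 h5) h4

/-- The punctured disk is the image of a half-plane under `exp`. -/
theorem isPathConnected_ball_zero_diff {R : ℝ} (hR : 0 < R) :
    IsPathConnected (Metric.ball (0 : ℂ) R \ {0}) := by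
  have h1 : IsPathConnected (Complex.exp '' {z | z.re < Real.log R}) := by
    refine IsPathConnected.image ?_ Complex.continuous_exp
    refine (convex_halfSpace_re_lt _).isPathConnected ⟨((Real.log R - 1 : ℝ) : ℂ), ?_⟩
    simp
  convert h1 using 1
  ext z
  simp only [Set.mem_sdiff, mem_ball_zero_iff, mem_singleton_iff, mem_image, mem_ofPred_eq]
  constructor
  · rintro ⟨hz, hz0⟩
    refine ⟨Complex.log z, ?_, Complex.exp_log hz0⟩
    rw [Complex.log_re]
    exact Real.log_lt_log (norm_pos_iff.2 hz0) hz
  · rintro ⟨u, hu, rfl⟩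
    rw [Complex.norm_exp]
    exact ⟨(Real.lt_log_iff_exp_lt hR).1 hu, Complex.exp_ne_zero u⟩

section SquareRoot

variable {k φ : ℂ → ℂ} {ρ : ℝ} {y₀ y z w₁ : ℂ}

theorem norm_sq_lt_of_sq_eq {w : ℂ} (hz : z ∈ Metric.ball y₀ ρ) (hw : w ^ 2 = z - y₀) :
    ‖w‖ ^ 2 < ρ := by
  rwa [← norm_pow, hw, ← dist_eq_norm]

/-- A germ `k (√(· - y₀))` continues along all paths in the punctured disk on which `k` is
analytic. -/
theorem exists_continuation_comp_sqrt (hk : ∀ w : ℂ, w ≠ 0 → ‖w‖ ^ 2 < ρ → AnalyticAt ℂ k w)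
    (hw₁ : w₁ ^ 2 = y - y₀) (τ : Path y z) (hτ : ∀ t, τ t ∈ Metric.ball y₀ ρ \ {y₀}) :
    ∃ (f : I → ℂ → ℂ) (w : ℂ), IsAnalyticContinuation τ univ f ∧
      (f 0 = fun z => k (sqrtBranch w₁ (z - y₀))) ∧ w ^ 2 = z - y₀ ∧ f 1 z = k w := by
  obtain ⟨ζ, hζ, hζ0, hsq⟩ := exists_continuousOn_sqrt τ.continuous (zero_le_one (α := I))
    (fun t _ => (hτ t).2) (by rw [τ.source]; exact hw₁)
  have hsq' : ∀ t, ζ t ^ 2 = τ t - y₀ := fun t => hsq t ⟨t.2.1, t.2.2⟩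
  have h0 : ∀ t, ζ t ≠ 0 := fun t h => (hτ t).2 (by
    have := hsq' t
    rw [h] at this
    exact sub_eq_zero.1 (this.symm.trans (by simp)))
  have h1 : ζ 1 ^ 2 = z - y₀ := by rw [hsq', τ.target]
  refine ⟨fun t z => k (sqrtBranch (ζ t) (z - y₀)), ζ 1,
    isAnalyticContinuation_comp_sqrtBranch hζ.continuousOn (fun t _ => h0 t) (fun t _ => hsq' t)
      fun t _ => hk _ (h0 t) (norm_sq_lt_of_sq_eq (hτ t).1 (hsq' t)), ?_, h1, ?_⟩
  · simp only [hζ0]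
  · simp only [← h1, sqrtBranch_self (h0 1)]

/-- The values of the continuations of a germ `k (√(· - y₀))` in a punctured disk are given by all
choices of the square root. -/
theorem continuationValues_comp_sqrt (hk : ∀ w : ℂ, w ≠ 0 → ‖w‖ ^ 2 < ρ → AnalyticAt ℂ k w)
    (hy : y ∈ Metric.ball y₀ ρ \ {y₀}) (hz : z ∈ Metric.ball y₀ ρ \ {y₀})
    (hw₁ : w₁ ^ 2 = y - y₀) (hφ : φ =ᶠ[𝓝 y] fun z => k (sqrtBranch w₁ (z - y₀))) :
    continuationValues φ (Metric.ball y₀ ρ \ {y₀}) y z = {v | ∃ w : ℂ, w ^ 2 = z - y₀ ∧ v = k w} := by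
  have hne : ∀ {x w : ℂ}, x ∈ Metric.ball y₀ ρ \ {y₀} → w ^ 2 = x - y₀ → w ≠ 0 := by
    rintro x w hx hw rfl
    exact hx.2 (sub_eq_zero.1 (hw.symm.trans (by simp)))
  ext v
  constructor
  · rintro ⟨τ, f, hτ, hf, hf0, rfl⟩
    obtain ⟨g, w, hg, hg0, hw, hgw⟩ := exists_continuation_comp_sqrt hk hw₁ τ hτ
    refine ⟨w, hw, ?_⟩
    have h1 := (hf.unique hg isPreconnected_univ (mem_univ 0) (mem_univ 1) (by
      rw [τ.source, hg0]; exact hf0.trans hφ)).eq_of_nhds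
    rw [τ.target] at h1
    rw [h1, hgw]
  · rintro ⟨w, hw, rfl⟩
    have hρ : 0 < ρ := Metric.nonempty_ball.1 ⟨y, hy.1⟩
    have hmem : ∀ {x w : ℂ}, x ∈ Metric.ball y₀ ρ \ {y₀} → w ^ 2 = x - y₀ →
        w ∈ Metric.ball (0 : ℂ) (√ρ) \ {0} := by
      intro x w hx hw
      refine ⟨?_, hne hx hw⟩
      rw [mem_ball_zero_iff]
      exact Real.lt_sqrt_of_sq_lt (norm_sq_lt_of_sq_eq hx.1 hw)
    -- Any path of roots from `w₁` to the prescribed root `w` projects under `w ↦ y₀ + w²` to a path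
    -- realizing that root; hence both signs occur.
    obtain ⟨ζ, hζ⟩ := (isPathConnected_ball_zero_diff (Real.sqrt_pos.2 hρ)).joinedIn w₁
      (hmem hy hw₁) w (hmem hz hw)
    have hlt : ∀ t, ‖ζ t‖ ^ 2 < ρ := fun t => by
      have := (hζ t).1
      rw [mem_ball_zero_iff] at this
      exact (Real.lt_sqrt (norm_nonneg _)).1 this
    set τ : Path y z := (ζ.map (f := fun w => y₀ + w ^ 2) (by fun_prop)).cast
      (by rw [hw₁]; ring) (by rw [hw]; ring) with hτdef
    have hτ : ∀ t, τ t = y₀ + ζ t ^ 2 := fun t => rfl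
    refine ⟨τ, fun t z => k (sqrtBranch (ζ t) (z - y₀)), fun t => ⟨?_, ?_⟩,
      isAnalyticContinuation_comp_sqrtBranch ζ.continuous.continuousOn (fun t _ => (hζ t).2)
        (fun t _ => by rw [hτ]; ring) (fun t _ => hk _ (hζ t).2 (hlt t)), ?_, ?_⟩
    · rw [hτ, Metric.mem_ball, dist_eq_norm, add_sub_cancel_left, norm_pow]
      exact hlt t
    · rw [hτ]
      simpa using (hζ t).2
    · simp only [ζ.source]
      exact hφ.symm
    · simp only [ζ.target, ← hw, sqrtBranch_self (hne hz hw)]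

end SquareRoot

/-! ### Assembly of the theorem -/

theorem theorem4p1 (p q : Polynomial ℂ) (a b y₀ : ℂ) (s : Path a b)
    (hb : q.eval b ≠ 0)
    (hcont : ∃ f : I → ℂ → ℂ, SolutionContinues p q s (Iio 1) y₀ f)
    (hsing : ¬ ∃ f : I → ℂ → ℂ, SolutionContinues p q s univ y₀ f) :
    ∃ (V : Set ℂ) (c : I) (r : ℝ) (x₀ : ℂ → ℂ) (γ : Set ℂ),
      IsOpen V ∧ y₀ ∈ V ∧ c < 1 ∧ 0 < r ∧
      -- the end part of the path lies in a disk around `b`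
      (∀ t, c ≤ t → s t ∈ Metric.ball b r) ∧
      -- `x₀ y` is the position of the singularity near `b` of the solution with value `y` at `a`
      (∀ y ∈ V, IsOnlySingularity p q s c (Metric.ball b r) y (x₀ y)) ∧
      x₀ y₀ = b ∧ AnalyticOnNhd ℂ x₀ V ∧ InjOn x₀ V ∧ (∀ y ∈ V, deriv x₀ y ≠ 0) ∧
      -- `γ` consists of the initial values for which this singularity lies on the path
      γ = {y ∈ V | ∃ t, c ≤ t ∧ x₀ y = s t} ∧
      -- the germ of `γ` at `y₀` is that of a real curve, as regular as the path is
      (∃ (c' : I) (κ : ℝ → ℂ), c ≤ c' ∧ c' < 1 ∧ κ 1 = y₀ ∧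
        ContinuousOn κ (Icc (c' : ℝ) 1) ∧
        (∀ t ∈ Icc (c' : ℝ) 1, κ t ∈ V ∧ x₀ (κ t) = s.extend t) ∧
        (∀ (n : ℕ∞) (J : Set ℝ), J ⊆ Icc (c' : ℝ) 1 →
          ContDiffOn ℝ n s.extend J → ContDiffOn ℝ n κ J) ∧
        ∀ᶠ y in 𝓝 y₀, y ∈ γ ↔ y ∈ κ '' Icc (c' : ℝ) 1) ∧
      -- off `γ` the germ of the Poincaré mapping along `s` is defined and regular
      (∀ y ∈ V \ γ, ∃ φ : ℂ → ℂ, IsPoincareGerm p q s y φ ∧ AnalyticAt ℂ φ y) ∧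
      -- continuation to a double-valued function, given by a Puiseux series
      ∃ (ρ : ℝ) (ν : ℕ → ℂ), 0 < ρ ∧ Metric.ball y₀ ρ ⊆ V ∧ ν 0 ≠ 0 ∧
        (∀ w : ℂ, ‖w‖ ^ 2 < ρ → Summable fun k : ℕ => ν k * w ^ k) ∧
        (∀ z ∈ Metric.ball y₀ ρ \ {y₀},
          {v : ℂ | ∃ w : ℂ, w ^ 2 = z - y₀ ∧ v = puiseuxSum ν w}.ncard = 2) ∧
        ∀ y ∈ (Metric.ball y₀ ρ \ {y₀}) \ γ, ∀ φ : ℂ → ℂ, IsPoincareGerm p q s y φ →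
          ∀ z ∈ Metric.ball y₀ ρ \ {y₀},
            (∀ τ : Path y z, (∀ t, τ t ∈ Metric.ball y₀ ρ \ {y₀}) → GermContinues φ τ) ∧
            continuationValues φ (Metric.ball y₀ ρ \ {y₀}) y z =
              {v : ℂ | ∃ w : ℂ, w ^ 2 = z - y₀ ∧ v = puiseuxSum ν w} := by
  obtain ⟨m, δ, H⟩ := exists_isLeafChart p q hb
  obtain ⟨f, hf⟩ := hcont
  obtain ⟨V, c, r, x₀, hV, hy₀, hc, hr0, hrδ, hr, hs, hleaf, hx₀, ha, hinj, hd, hne⟩ :=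
    exists_singularity_position H hf hsing
  obtain ⟨ρ, ν, hρ, hρV, hν0, hsum, hPa, hP⟩ := H.exists_puiseux hr hV hy₀ hx₀ ha (hd y₀ hy₀)
    fun y hy => (hleaf y hy).1
  have hsIcc : ∀ t ∈ Icc c 1, s t ∈ Metric.ball b r := fun t ht => hs t ht.1
  refine ⟨V, c, r, x₀, _, hV, hy₀, hc, hr0, hs, fun y hy => (hleaf y hy).2.isOnlySingularity H hrδ hr
    (hleaf y hy).1 (hs c le_rfl), hx₀, ha, hinj, hd, rfl,
    exists_preimage_curve hV hy₀ hc hx₀ ha hinj hd hne, ?_, ρ, ν, hρ, hρV, hν0, hsum, ?_, ?_⟩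
  · rintro y ⟨hy, hyγ⟩
    obtain ⟨F, hF, -⟩ := (hleaf y hy).2.solutionContinues H hrδ hr (hleaf y hy).1 hc.le hsIcc
      fun t ht h => hyγ ⟨hy, t, ht.1, h.symm⟩
    rw [Iic_one_unitInterval] at hF
    exact hF.exists_poincareGerm
  · intro z hz
    obtain ⟨w, hw⟩ := IsAlgClosed.exists_pow_nat_eq (z - y₀) (n := 2) (by norm_num)
    have hw0 : w ≠ 0 := by
      rintro rfl
      exact hz.2 (sub_eq_zero.1 (hw.symm.trans (by simp)))
    have hlt := norm_sq_lt_of_sq_eq hz.1 hw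
    obtain ⟨w', hw'0, hw'δ, hw', h1, h2⟩ := hP w hw0 hlt
    have hset : {v : ℂ | ∃ w : ℂ, w ^ 2 = z - y₀ ∧ v = puiseuxSum ν w} =
        {puiseuxSum ν w, puiseuxSum ν (-w)} := by
      ext v
      simp only [mem_ofPred_eq, mem_insert_iff, mem_singleton_iff]
      constructor
      · rintro ⟨u, hu, rfl⟩
        rw [← hw] at hu
        rcases sq_eq_sq_iff_eq_or_eq_neg.1 hu with rfl | rfl
        · exact Or.inl rfl
        · exact Or.inr rfl
      · rintro (rfl | rfl)
        · exact ⟨w, hw, rfl⟩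
        · exact ⟨-w, by rw [neg_sq, hw], rfl⟩
    rw [hset, ncard_pair]
    rw [h1, h2]
    refine H.leafValue_ne_neg hw'δ hw'0 (Metric.ball_subset_ball hrδ (hleaf _ (hρV ?_)).1)
    rw [hw, add_sub_cancel]
    exact hz.1
  · rintro y ⟨hy, -⟩ φ hφ z hz
    obtain ⟨w, hw⟩ := IsAlgClosed.exists_pow_nat_eq (y - y₀) (n := 2) (by norm_num)
    have hw0 : w ≠ 0 := by
      rintro rfl
      exact hy.2 (sub_eq_zero.1 (hw.symm.trans (by simp)))
    have hlt := norm_sq_lt_of_sq_eq hy.1 hw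
    have hβ := analyticAt_sqrtBranch_sub hw0 hw
    have hPβ : AnalyticAt ℂ (fun z => puiseuxSum ν (sqrtBranch w (z - y₀))) y := by
      refine AnalyticAt.comp (g := puiseuxSum ν) ?_ hβ
      rw [← hw, sqrtBranch_self hw0]
      exact hPa w hw0 hlt
    have hPβ' : AnalyticAt ℂ (fun z => puiseuxSum ν (-sqrtBranch w (z - y₀))) y := by
      refine AnalyticAt.comp (g := puiseuxSum ν) ?_ hβ.neg
      rw [← hw, sqrtBranch_self hw0]
      exact hPa (-w) (neg_ne_zero.2 hw0) (by rwa [norm_neg])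
    -- The value `φ x` is the leaf value at some root of `b - x₀ x`, and the two roots give the two
    -- Puiseux values. Analyticity then selects one branch for the whole germ.
    have hval : ∀ᶠ x in 𝓝 y, φ x = puiseuxSum ν (sqrtBranch w (x - y₀)) ∨
        φ x = puiseuxSum ν (-sqrtBranch w (x - y₀)) := by
      filter_upwards [hφ, Metric.isOpen_ball.mem_nhds hy.1, eventually_ne_nhds hy.2]
        with x hx hxρ hxne
      obtain ⟨G, hG, hGφ⟩ := hx
      have hxV := hleaf x (hρV hxρ)
      have hG' := hG
      rw [← Iic_one_unitInterval] at hG'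
      obtain ⟨F, hF, u, hu, hFu⟩ := hxV.2.solutionContinues H hrδ hr hxV.1 hc.le hsIcc
        (hxV.2.ne_of_solutionContinues H hrδ hr hxV.1 hc.le hsIcc hG')
      have h1 := (hF.unique hG' isPreconnected_Iic (zero_mem_Iic_unitInterval 1)
        self_mem_Iic).eq_of_nhds
      rw [s.target] at h1 hFu hu
      rw [← hGφ, ← h1, hFu]
      have hβx : sqrtBranch w (x - y₀) ^ 2 = x - y₀ := sqrtBranch_sq hw0 _
      have hβ0 : sqrtBranch w (x - y₀) ≠ 0 := fun h => hxne (by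
        rw [h] at hβx
        exact sub_eq_zero.1 (hβx.symm.trans (by simp)))
      obtain ⟨w', -, -, hw', h2, h3⟩ := hP _ hβ0 (norm_sq_lt_of_sq_eq hxρ hβx)
      rw [hβx, add_sub_cancel] at hw' h2 h3
      rw [h2, h3]
      rw [← hw'] at hu
      rcases sq_eq_sq_iff_eq_or_eq_neg.1 hu with rfl | rfl
      · exact Or.inl rfl
      · exact Or.inr rfl
    have hgerm : ∃ w₁ : ℂ, w₁ ^ 2 = y - y₀ ∧
        φ =ᶠ[𝓝 y] fun z => puiseuxSum ν (sqrtBranch w₁ (z - y₀)) := by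
      rcases hφ.analyticAt.eventuallyEq_or_eventuallyEq hPβ hPβ' hval with h1 | h1
      · exact ⟨w, hw, h1⟩
      · exact ⟨-w, by rw [neg_sq, hw], by simpa only [sqrtBranch_neg] using h1⟩
    obtain ⟨w₁, hw₁, hφw⟩ := hgerm
    refine ⟨fun τ hτ => ?_, continuationValues_comp_sqrt hPa hy hz hw₁ hφw⟩
    obtain ⟨g, -, hg, hg0, -⟩ := exists_continuation_comp_sqrt hPa hw₁ τ hτ
    exact ⟨g, hg, by rw [hg0]; exact hφw.symm⟩
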